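/- Let $\mathfrak o$ be a compact discrete valuation ring (of arbitrary characteristic) with maximal ideal $\mathfrak p$ and residue field of cardinality $q$, and let $n\ge 1$. For $N\ge 0$ put $\mathfrak o_N=\mathfrak o/\mathfrak p^N$. Let $\mathfrak{sl}_n(\mathfrak o_N)$ be the set of $n\times n$ matrices of trace zero over $\mathfrak o_N$, let $\mathfrak{sl}_n(\mathfrak o_N)^*=\mathfrak{sl}_n(\mathfrak o_N)\setminus \mathfrak p\cdot\mathfrak{sl}_n(\mathfrak o_N)$ for $N\ge 1$, and let $\mathfrak{sl}_n(\mathfrak o_0)^*=\{0\}$. For $x\in\mathfrak{sl}_n(\mathfrak o_N)^*$ let $\mathrm{im}(x)$ be the image of $x$, viewed as an endomorphism of $\mathfrak o_N^n$. Then every $|\mathrm{im}(x)|$ is a power of $q$, and for every $m$ there are only finitely many pairs $(N,x)$, $x\in\mathfrak{sl}_n(\mathfrak o_N)^*$, with $|\mathrm{im}(x)|=q^m$. Hence, with $t=q^{-s}$, the image zeta function $$\mathcal P_{n,\mathfrak o}(s)=\sum_{N=0}^\infty\ \sum_{x\in\mathfrak{sl}_n(\mathfrak o_N)^*}|\mathrm{im}(x)|^{-s}\in\mathbb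 Q[[t]]$$ is a well-defined formal power series. Let $S_n$ be the symmetric group on $\{1,\dots,n\}$ with Coxeter generators $s_j=(j\ \,j+1)$, $1\le j\le n-1$, let $\ell$ be the Coxeter length, and put $\mathrm{Des}(w)=\{j\in\{1,\dots,n-1\} : \ell(ws_j)<\ell(w)\}$. For $I=\{i_1<\dots<i_r\}\subseteq\{1,\dots,n-1\}$ put $\binom nI_Y=\binom{n}{i_r}_Y\binom{i_r}{i_{r-1}}_Y\cdots\binom{i_2}{i_1}_Y$ with $\binom ab_Y=\prod_{j=1}^{b}\frac{1-Y^{a-b+j}}{1-Y^j}$, and let $$I_n(Y;X_1,\dots,X_n)=\frac1{1-X_n}\sum_{I\subseteq\{1,\dots,n-1\}}\binom nI_Y\prod_{i\in I}\frac{X_i}{1-X_i}$$ be the Igusa function of degree $n$. Then $$\mathcal P_{n,\mathfrak o}(s)=\Bigl(\sum_{w\in S_n}q^{-\ell(w)}\prod_{j\in\mathrm{Des}(w)}q^{n^2-j^2-1-s(n-j)}\Bigr)\prod_{j=0}^{n-1}\frac{1-q^{j-s}}{1-q^{n^2-j^2-1-s(n-j)}}$$ and $$\mathcal P_{n,\mathfrak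 o}(s)=I_n\bigl(q^{-1};X_1,\dots,X_n\bigr)\prod_{j=0}^{n-1}(1-q^jt),\qquad X_k=q^{n^2-(n-k)^2-1}\,t^{k}\quad(1\le k\le n),$$ as identities of formal series in $t$, all rational functions being expanded at $t=0$. Moreover, for every complex number $s$ with $\mathrm{Re}(s)>2n-2$ the double series defining $\mathcal P_{n,\mathfrak o}(s)$ converges absolutely, and its sum is given by the first formula. -/

import Mathlib

open scoped LaurentSeries PowerSeries

/-! ### Coxeter statistics on the symmetric group

The symmetric group of degree `n` is `Equiv.Perm (Fin n)`; the letter `k + 1` of `{1, …, n}` is the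
element `k` of `Fin n`. -/

namespace SymmetricGroup

/-- The standard transposition `s_j`, interchanging the letters `j` and `j + 1` (that is, the
elements `j - 1` and `j` of `Fin n`), for `1 ≤ j ≤ n - 1`. Outside this range it is defined to be
the identity. -/
def simpleTransposition (n j : ℕ) : Equiv.Perm (Fin n) :=
  if h : 1 ≤ j ∧ j < n then Equiv.swap ⟨j - 1, by omega⟩ ⟨j, h.2⟩ else 1

/-- The Coxeter length: the least number of factors in an expression of `w` as a product of
the standard transpositions `s_1, …, s_{n-1}`. -/
noncomputable def length {n : ℕ} (w : Equiv.Perm (Fin n)) : ℕ :=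
  sInf {k | ∃ l : List ℕ, (∀ j ∈ l, 1 ≤ j ∧ j < n) ∧ l.length = k ∧
    (l.map (simpleTransposition n)).prod = w}

/-- The descent set `{j ∈ {1, …, n - 1} | ℓ(w s_j) < ℓ(w)}`. -/
noncomputable def descents {n : ℕ} (w : Equiv.Perm (Fin n)) : Finset ℕ :=
  {j ∈ Finset.Ico 1 n | length (w * simpleTransposition n j) < length w}

end SymmetricGroup

/-! ### Igusa functions -/

section Igusa

variable {K : Type*} [Field K]

/-- The `Y`-binomial coefficient `∏_{j=1}^{i} (1 - Y^{n-i+j}) / (1 - Y^j)` (for `i ≤ n`), evaluated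
at an element `Y` of a field such that `Y ^ j ≠ 1` for `1 ≤ j ≤ i`. -/
def qBinomial (Y : K) (n i : ℕ) : K :=
  ∏ j ∈ Finset.Icc 1 i, (1 - Y ^ (n - i + j)) / (1 - Y ^ j)

/-- `binom(n, i_ℓ) * binom(i_ℓ, i_{ℓ-1}) * ⋯ * binom(i_2, i_1)` for the list
`[i_ℓ, i_{ℓ-1}, …, i_1]`. -/
def qMultinomialList (Y : K) : ℕ → List ℕ → K
  | _, [] => 1
  | n, i :: l => qBinomial Y n i * qMultinomialList Y i l

/-- The `Y`-multinomial coefficient `binom(n, I)_Y` of a finite set `I = {i_1 < ⋯ < i_ℓ}`. -/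
def qMultinomial (Y : K) (n : ℕ) (I : Finset ℕ) : K :=
  qMultinomialList Y n (I.sort (· ≥ ·))

/-- The Igusa function `I_n(Y; X_1, …, X_n)` of degree `n`, evaluated at elements `Y` and
`X_1, …, X_n` of a field for which no denominator vanishes:
`(1 - X_n)⁻¹ * ∑_{I ⊆ {1, …, n-1}} binom(n, I)_Y * ∏_{i ∈ I} X_i / (1 - X_i)`.
Only the values `X 1, …, X n` are used. -/
def igusa (n : ℕ) (Y : K) (X : ℕ → K) : K :=
  1 / (1 - X n) *
    ∑ I ∈ (Finset.Ico 1 n).powerset, qMultinomial Y n I * ∏ i ∈ I, X i / (1 - X i)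

end Igusa

/-! ### Primitive traceless matrices and the image zeta function -/

section ImageZeta

variable (o : Type*) [CommRing o] [IsLocalRing o]

/-- The ring `o_N = o / 𝔭 ^ N`, where `𝔭` is the maximal ideal of `o`. -/
abbrev LevelRing (N : ℕ) : Type _ := o ⧸ IsLocalRing.maximalIdeal o ^ N

/-- `𝔰𝔩_n(R)`: the `n × n` matrices over `R` of trace zero. -/
def traceless (n : ℕ) (R : Type*) [CommRing R] : Submodule R (Matrix (Fin n) (Fin n) R) :=
  LinearMap.ker (Matrix.traceLinearMap (Fin n) R R)

/-- The set of primitive traceless matrices of level `N`: for `N ≥ 1` the set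
`𝔰𝔩_n(o_N) \ 𝔭 · 𝔰𝔩_n(o_N)`, and for `N = 0` the set `{0}`. -/
def primitiveTraceless (n N : ℕ) : Set (Matrix (Fin n) (Fin n) (LevelRing o N)) :=
  if N = 0 then {0} else
    {x | x ∈ traceless n (LevelRing o N) ∧
      x ∉ (IsLocalRing.maximalIdeal o).map (Ideal.Quotient.mk (IsLocalRing.maximalIdeal o ^ N)) •
        traceless n (LevelRing o N)}

/-- The pairs `(N, x)` of a level `N` and a primitive traceless matrix `x` of level `N`. -/
abbrev PrimitiveTraceless (n : ℕ) : Type _ := Σ N : ℕ, primitiveTraceless o n N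

variable {o}

/-- The cardinality of the image of `x`, viewed as an endomorphism of `o_N ^ n`. -/
noncomputable def imageSize {n : ℕ} (p : PrimitiveTraceless o n) : ℕ :=
  Nat.card (LinearMap.range (Matrix.mulVecLin p.2.1))

variable (o)

/-- The image zeta function `∑_N ∑_x |im x| ^ (-s)` as a formal power series in `t = q ^ (-s)`,
where `q` is the cardinality of the residue field: the coefficient of `t ^ m` is the number of
pairs `(N, x)` with `|im x| = q ^ m`. -/
noncomputable def imageZeta (n : ℕ) : ℚ⟦X⟧ :=
  PowerSeries.mk fun m =>
    (Nat.card {p : PrimitiveTraceless o n //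
      imageSize p = Nat.card (IsLocalRing.ResidueField o) ^ m} : ℚ)

end ImageZeta

/-! The problem becomes one of counting lattices in `o ^ n` by index and exponent. Pull the kernel
of a matrix `x` of level `N` back to `o ^ n`: this is a lattice of index `|im x|`. Multiplication by
`ϖ ^ (e - N)` identifies the primitive traceless matrices of all levels `N ≤ e` with all traceless
matrices of level `e`, without changing the kernel lattice (`exists_equiv_traceless`).

Now count pairs `(x, L)` with `L` a lattice inside the kernel of `x`. For fixed `x` the kernel
lattice is isomorphic to `o ^ n`, so its sublattices are counted like those of `o ^ n`. For fixed
`L` of index `q ^ m` with elementary divisors `ϖ ^ l j`, an adapted basis turns the condition into: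
column `j` is killed by `ϖ ^ l j`. There are `q ^ (n m)` such matrices, and the trace maps them onto
the torsion killed by `ϖ ^ max l`, so `q ^ (n m - max l)` of them are traceless
(`card_traceless_le_kernelLattice`). Writing `len L` for `m` and `exp L` for `max l`, this gives
`P(t) * ∑_L t ^ len L = ∑_L q ^ (n len L - exp L) t ^ len L` (`imageZeta_mul_latticeSeries`).

Both sums are instances of `latticeSeries`, with weight `c ^ len L * u ^ exp L`. If the reduction
`W` of `L` modulo `ϖ` has codimension `i` and dimension `k`, then in suitable coordinates `L`
consists of the `(ϖ a, c)` with `a` in the class `φ c`, for a lattice `L'` in `o ^ i` and a linear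
map `φ` from `o ^ k` to `o ^ i / L'`; for `i ≥ 1` the exponent drops by one from `L` to `L'`.
Summing over `W` yields a recursion. The Igusa function obeys the same recursion, obtained by
splitting off the largest element of the index set (`one_sub_mul_igusa`), so the series is `I_n(q⁻¹;
q ^ (k (n - k)) c ^ k u t ^ k)` (`ofPowerSeries_latticeSeries`). For `u = 1` it collapses to `∏ 1 /
(1 - q ^ j c t)` by a `q`-binomial identity (`latticeSeries_mul_prod`). Taking `c = q ^ n`, `u =
q⁻¹` gives the second formula.

The first formula follows because `Y`-multinomials are generating functions of the length over
permutations with restricted descents, which turns the sum over subsets into one over `S_n`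
(`igusa_eq_sum_perm`). For `Re s > 2n - 2` all terms `q ^ (n² - j² - 1) t ^ (n - j)` have norm below
`1`. The formal identity can then be evaluated, and since the coefficients are counts, the double
series converges absolutely as well. -/

/-! ### Inversions and the Coxeter length -/

namespace SymmetricGroup

/-- The number of inversions of a permutation. -/
def inversions {n : ℕ} (w : Equiv.Perm (Fin n)) : ℕ :=
  ∑ x, ∑ y, if x < y ∧ w y < w x then 1 else 0

/-- `j` is a descent of `w` if the letter `j + 1` has a smaller value than the letter `j`. -/
def IsDescent {n : ℕ} (w : Equiv.Perm (Fin n)) (j : ℕ) : Prop :=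
  ∃ h : 1 ≤ j ∧ j < n, w ⟨j, h.2⟩ < w ⟨j - 1, by omega⟩

theorem inversions_one (n : ℕ) : inversions (1 : Equiv.Perm (Fin n)) = 0 := by
  refine Finset.sum_eq_zero fun x _ => Finset.sum_eq_zero fun y _ => if_neg ?_
  rintro ⟨h, h'⟩
  exact lt_asymm h h'

/-- Swapping neighbouring positions preserves the order of every pair of positions except that pair
itself. After reindexing the double sum by the swap, exactly one new inversion remains. -/
theorem inversions_mul_swap {n : ℕ} (w : Equiv.Perm (Fin n)) (a b : Fin n)
    (hab : (b : ℕ) = a + 1) (h : w a < w b) :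
    inversions (w * Equiv.swap a b) = inversions w + 1 := by
  have hne : a ≠ b := fun h => by simp [h] at hab
  set s := Equiv.swap a b with hs
  have hss : ∀ x, s (s x) = x := fun x => by simp [hs]
  have key : ∀ x y, (if s x < s y ∧ w y < w x then 1 else 0 : ℕ) =
      (if x < y ∧ w y < w x then 1 else 0) + if x = b ∧ y = a then 1 else 0 := by
    intro x y
    by_cases hxb : x = b ∧ y = a
    · obtain ⟨rfl, rfl⟩ := hxb
      have h1 : y < x := Fin.lt_def.2 (by omega)
      simp [hs, h1, h, lt_asymm h1]
    · by_cases hxa : x = a ∧ y = b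
      · obtain ⟨rfl, rfl⟩ := hxa
        simp [lt_asymm h, hxb]
      · have : s x < s y ↔ x < y := by
          rw [Fin.ext_iff, Fin.ext_iff] at hxb hxa
          simp only [hs, Equiv.swap_apply_def, Fin.lt_def]
          split_ifs with h1 h2 h2 h2 h2 <;> rw [Fin.ext_iff] at * <;> omega
        simp [this, hxb]
  have h1 : inversions (w * s) = ∑ x, ∑ y, if s x < s y ∧ w y < w x then 1 else 0 := by
    rw [inversions, ← Equiv.sum_comp s]
    refine Finset.sum_congr rfl fun x _ => ?_
    rw [← Equiv.sum_comp s]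
    simp [hss]
  rw [h1]
  simp_rw [key, Finset.sum_add_distrib]
  rw [inversions]
  congr 1
  simp [ite_and]

theorem simpleTransposition_mul_self (n j : ℕ) :
    simpleTransposition n j * simpleTransposition n j = 1 := by
  unfold simpleTransposition
  split_ifs <;> simp

theorem inversions_mul_simpleTransposition {n j : ℕ} (w : Equiv.Perm (Fin n)) (hj : 1 ≤ j)
    (hn : j < n) (h : ¬ IsDescent w j) :
    inversions (w * simpleTransposition n j) = inversions w + 1 := by
  have : simpleTransposition n j = Equiv.swap ⟨j - 1, by omega⟩ ⟨j, hn⟩ := by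
    simp [simpleTransposition, hj, hn]
  rw [this]
  refine inversions_mul_swap _ _ _ (by simp; omega) ?_
  refine lt_of_le_of_ne (not_lt.1 fun h' => h ⟨⟨hj, hn⟩, h'⟩) fun h' => ?_
  have := Fin.ext_iff.1 (w.injective h')
  simp at this
  omega

theorem not_isDescent_mul_simpleTransposition {n j : ℕ} {w : Equiv.Perm (Fin n)}
    (h : IsDescent w j) : ¬ IsDescent (w * simpleTransposition n j) j := by
  obtain ⟨hj, h⟩ := h
  rintro ⟨_, h'⟩
  simp [simpleTransposition, hj] at h'
  exact lt_asymm h h'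

theorem inversions_mul_simpleTransposition_of_isDescent {n j : ℕ} {w : Equiv.Perm (Fin n)}
    (h : IsDescent w j) : inversions w = inversions (w * simpleTransposition n j) + 1 := by
  have := inversions_mul_simpleTransposition (w * simpleTransposition n j) h.1.1 h.1.2
    (not_isDescent_mul_simpleTransposition h)
  rwa [mul_assoc, simpleTransposition_mul_self, mul_one] at this

theorem strictMono_of_forall_not_isDescent {m n : ℕ} (hm : m ≤ n) {w : Equiv.Perm (Fin n)}
    (h : ∀ j, j < m → ¬ IsDescent w j) : StrictMono (fun i : Fin m => w (Fin.castLE hm i)) := by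
  cases m with
  | zero => exact fun i => i.elim0
  | succ m =>
    refine Fin.strictMono_iff_lt_succ.2 fun i => ?_
    refine lt_of_le_of_ne (not_lt.1 fun h' => h (i + 1) (by omega) ⟨⟨by omega, by omega⟩, h'⟩) ?_
    intro h'
    have := Fin.ext_iff.1 (w.injective h')
    simp at this

theorem eq_one_of_forall_not_isDescent {n : ℕ} {w : Equiv.Perm (Fin n)}
    (h : ∀ j, ¬ IsDescent w j) : w = 1 := by
  have hw : StrictMono w := strictMono_of_forall_not_isDescent le_rfl fun j _ => h j
  ext x
  exact Fin.coe_orderIso_apply (hw.orderIsoOfSurjective w w.surjective) x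

/-- Sorting by neighbouring swaps: a permutation other than the identity has a descent, and swapping
there removes one inversion. -/
theorem exists_word (N : ℕ) {n : ℕ} (w : Equiv.Perm (Fin n)) (hw : inversions w = N) :
    ∃ l : List ℕ, (∀ j ∈ l, 1 ≤ j ∧ j < n) ∧ l.length = N ∧
      (l.map (simpleTransposition n)).prod = w := by
  induction N generalizing w with
  | zero =>
    refine ⟨[], by simp, rfl, ?_⟩
    rw [eq_one_of_forall_not_isDescent (w := w)]
    · rfl
    · intro j hj
      have := inversions_mul_simpleTransposition_of_isDescent hj
      omega
  | succ N ih =>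
    by_cases h : ∃ j, IsDescent w j
    · obtain ⟨j, hj⟩ := h
      have := inversions_mul_simpleTransposition_of_isDescent hj
      obtain ⟨l, h1, h2, h3⟩ := ih (w * simpleTransposition n j) (by omega)
      refine ⟨l ++ [j], ?_, by simp [h2], ?_⟩
      · intro i hi
        rcases List.mem_append.1 hi with hi | hi
        · exact h1 i hi
        · rw [List.mem_singleton.1 hi]
          exact hj.1
      · rw [List.map_append, List.prod_append, h3]
        simp [mul_assoc, simpleTransposition_mul_self]
    · rw [eq_one_of_forall_not_isDescent (not_exists.1 h), inversions_one] at hw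
      omega

theorem inversions_prod_le {n : ℕ} (l : List ℕ) (hl : ∀ j ∈ l, 1 ≤ j ∧ j < n) :
    inversions (l.map (simpleTransposition n)).prod ≤ l.length := by
  induction l using List.reverseRecOn with
  | nil => simp [inversions_one]
  | append_singleton l j ih =>
    have h1 := ih fun i hi => hl i (by simp [hi])
    have h2 := hl j (by simp)
    rw [List.map_append, List.prod_append]
    simp only [List.map_cons, List.map_nil, List.prod_cons, List.prod_nil, mul_one,
      List.length_append, List.length_cons, List.length_nil]
    by_cases h : IsDescent (l.map (simpleTransposition n)).prod j
    · have := inversions_mul_simpleTransposition_of_isDescent h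
      omega
    · have := inversions_mul_simpleTransposition _ h2.1 h2.2 h
      omega

theorem length_eq_inversions {n : ℕ} (w : Equiv.Perm (Fin n)) : length w = inversions w := by
  refine le_antisymm (Nat.sInf_le (exists_word _ w rfl)) (le_csInf ⟨_, exists_word _ w rfl⟩ ?_)
  rintro k ⟨l, h1, rfl, rfl⟩
  exact inversions_prod_le l h1

theorem mem_descents {n : ℕ} {w : Equiv.Perm (Fin n)} {j : ℕ} :
    j ∈ descents w ↔ IsDescent w j := by
  rw [descents, Finset.mem_filter, Finset.mem_Ico, length_eq_inversions, length_eq_inversions]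
  constructor
  · rintro ⟨⟨h1, h2⟩, h⟩
    by_contra h'
    have := inversions_mul_simpleTransposition w h1 h2 h'
    omega
  · intro h
    have := inversions_mul_simpleTransposition_of_isDescent h
    exact ⟨h.1, by omega⟩

end SymmetricGroup

/-! ### Gaussian binomial coefficients -/

section QBinomial

variable {K : Type*} [Field K]

/-- The `Y`-factorial `∏_{j=1}^{n} (1 - Y^j)`. -/
def qFactorial (Y : K) (n : ℕ) : K := ∏ j ∈ Finset.range n, (1 - Y ^ (j + 1))

theorem qFactorial_ne_zero {Y : K} (hY : ∀ j, 1 ≤ j → Y ^ j ≠ 1) (n : ℕ) : qFactorial Y n ≠ 0 :=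
  Finset.prod_ne_zero_iff.2 fun j _ => sub_ne_zero.2 (hY (j + 1) (by omega)).symm

theorem qFactorial_succ (Y : K) (n : ℕ) :
    qFactorial Y (n + 1) = qFactorial Y n * (1 - Y ^ (n + 1)) :=
  Finset.prod_range_succ _ _

theorem qBinomial_eq {Y : K} (hY : ∀ j, 1 ≤ j → Y ^ j ≠ 1) (m k : ℕ) :
    qBinomial Y (m + k) k = qFactorial Y (m + k) / (qFactorial Y m * qFactorial Y k) := by
  have h : qBinomial Y (m + k) k = (∏ j ∈ Finset.range k, (1 - Y ^ (m + j + 1))) /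
      qFactorial Y k := by
    rw [qBinomial, qFactorial, ← Finset.prod_div_distrib, ← Finset.Ico_succ_right_eq_Icc,
      Finset.prod_Ico_eq_prod_range]
    refine Finset.prod_congr (by simp) fun j _ => ?_
    rw [Nat.add_sub_cancel, add_comm 1 j, add_assoc]
  rw [h, div_eq_div_iff (qFactorial_ne_zero hY k)
    (mul_ne_zero (qFactorial_ne_zero hY m) (qFactorial_ne_zero hY k)), qFactorial, qFactorial,
    qFactorial, Finset.prod_range_add]
  simp only [add_assoc]
  ring

theorem qBinomial_zero_right (Y : K) (n : ℕ) : qBinomial Y n 0 = 1 := by simp [qBinomial]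

theorem qBinomial_self {Y : K} (hY : ∀ j, 1 ≤ j → Y ^ j ≠ 1) (n : ℕ) : qBinomial Y n n = 1 := by
  have := qBinomial_eq hY 0 n
  rw [zero_add] at this
  rw [this]
  rw [show qFactorial Y 0 = 1 from Finset.prod_range_zero _, one_mul]
  exact div_self (qFactorial_ne_zero hY n)

theorem qBinomial_pascal {Y : K} (hY : ∀ j, 1 ≤ j → Y ^ j ≠ 1) (m k : ℕ) :
    qBinomial Y (m + 1 + (k + 1)) (k + 1) =
      qBinomial Y (m + 1 + k) k + Y ^ (k + 1) * qBinomial Y (m + (k + 1)) (k + 1) := by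
  rw [qBinomial_eq hY, qBinomial_eq hY, qBinomial_eq hY, show m + 1 + k = m + k + 1 by ring,
    show m + (k + 1) = m + k + 1 by ring, show m + 1 + (k + 1) = m + k + 1 + 1 by ring]
  simp only [qFactorial_succ]
  have h1 := qFactorial_ne_zero hY m
  have h2 := qFactorial_ne_zero hY k
  have h3 : 1 - Y ^ (m + 1) ≠ 0 := sub_ne_zero.2 (hY _ (by omega)).symm
  have h4 : 1 - Y ^ (k + 1) ≠ 0 := sub_ne_zero.2 (hY _ (by omega)).symm
  field_simp
  ring

/-- `binom(n, k)` as the sum over the `k`-complements of `Y` to the number of inversions. -/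
theorem sum_powersetCard_range {Y : K} (hY : ∀ j, 1 ≤ j → Y ^ j ≠ 1) (k m : ℕ) :
    ∑ B ∈ (Finset.range (m + k)).powersetCard m, Y ^ ∑ c ∈ B, (Finset.range c \ B).card =
      qBinomial Y (m + k) k := by
  induction m generalizing k with
  | zero => simp [qBinomial_self hY]
  | succ m ihm =>
    induction k with
    | zero =>
      rw [qBinomial_zero_right, add_zero]
      have h := Finset.powersetCard_self (Finset.range (m + 1))
      rw [Finset.card_range] at h
      rw [h, Finset.sum_singleton, Finset.sum_eq_zero, pow_zero]
      intro c hc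
      rw [Finset.card_eq_zero, Finset.sdiff_eq_empty_iff_subset]
      exact Finset.range_subset_range.2 (Finset.mem_range.1 hc).le
    | succ k ihk =>
      -- The two Pascal terms are the sets `B` without and with the largest element. When it lies in
      -- `B`, it exceeds all `k + 1` elements of the complement, whence the factor `Y ^ (k + 1)`.
      rw [qBinomial_pascal hY, ← ihk, ← ihm (k + 1), ← add_assoc (m + 1) k 1, Finset.range_add_one,
        Finset.powersetCard_succ_insert Finset.notMem_range_self, Finset.sum_union, Finset.sum_image]
      · congr 1
        rw [Finset.mul_sum]
        refine Finset.sum_congr (by congr 2; ring) fun B hB => ?_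
        obtain ⟨hB, hc⟩ := Finset.mem_powersetCard.1 hB
        rw [show m + (k + 1) = m + 1 + k by ring] at hB
        have hn : m + 1 + k ∉ B := fun h => Finset.notMem_range_self (hB h)
        rw [Finset.sum_insert hn, pow_add]
        congr 2
        · rw [Finset.sdiff_insert, Finset.erase_eq_of_notMem (by simp),
            Finset.card_sdiff_of_subset hB, hc, Finset.card_range]
          omega
        · refine Finset.sum_congr rfl fun c hc => ?_
          have := Finset.mem_range.1 (hB hc)
          rw [Finset.sdiff_insert, Finset.erase_eq_of_notMem]
          simp
          omega
      · intro A hA B hB h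
        have hA' : m + 1 + k ∉ A := fun h => Finset.notMem_range_self
          ((Finset.mem_powersetCard.1 hA).1 h)
        have hB' : m + 1 + k ∉ B := fun h => Finset.notMem_range_self
          ((Finset.mem_powersetCard.1 hB).1 h)
        rw [← Finset.erase_insert hA', ← Finset.erase_insert hB']
        exact congrArg (fun s => Finset.erase s (m + 1 + k)) h
      · refine Finset.disjoint_left.2 fun B hB hB' => ?_
        obtain ⟨C, _, rfl⟩ := Finset.mem_image.1 hB'
        exact Finset.notMem_range_self ((Finset.mem_powersetCard.1 hB).1
          (Finset.mem_insert_self _ _))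

theorem sum_powersetCard_fin {Y : K} (hY : ∀ j, 1 ≤ j → Y ^ j ≠ 1) (k m : ℕ) :
    ∑ B ∈ (Finset.univ : Finset (Fin (m + k))).powersetCard m,
      Y ^ (∑ c ∈ B, ∑ b ∈ Bᶜ, if b < c then 1 else 0) = qBinomial Y (m + k) k := by
  rw [← sum_powersetCard_range hY, ← Nat.Iio_eq_range, ← Fin.map_valEmbedding_univ,
    Finset.powersetCard_map, Finset.sum_map]
  refine Finset.sum_congr rfl fun B _ => ?_
  congr 1
  simp only [Finset.mapEmbedding_apply, RelEmbedding.coe_toEmbedding, Finset.sum_map]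
  refine Finset.sum_congr rfl fun c _ => ?_
  rw [← Finset.card_filter]
  refine (Finset.card_map Fin.valEmbedding).symm.trans (congrArg _ ?_)
  ext x
  simp only [Finset.mem_map, Finset.mem_filter, Finset.mem_compl, Finset.mem_sdiff,
    Finset.mem_range, Fin.valEmbedding_apply]
  constructor
  · rintro ⟨b, ⟨hb, hbc⟩, rfl⟩
    refine ⟨hbc, ?_⟩
    rintro ⟨b', hb', h⟩
    exact hb (Fin.ext h ▸ hb')
  · rintro ⟨hx, h⟩
    exact ⟨⟨x, hx.trans c.2⟩, ⟨fun h' => h ⟨_, h', rfl⟩, hx⟩, rfl⟩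

end QBinomial

/-! ### The distribution of the length over permutations with prescribed descents -/

namespace SymmetricGroup

/-- The permutation of `Fin (m + k)` that increases from `Fin m` onto `B` and, up to `σ`,
from the remaining letters onto the complement of `B`. -/
noncomputable def shuffle {m k : ℕ} (B : Finset (Fin (m + k))) (hB : B.card = m)
    (σ : Equiv.Perm (Fin k)) : Equiv.Perm (Fin (m + k)) :=
  finSumFinEquiv.symm.trans ((Equiv.sumCongr (Equiv.refl (Fin m)) σ).trans
    (finSumEquivOfFinset hB (by simp [Finset.card_compl, hB])))

section Shuffle

variable {m k : ℕ} {B : Finset (Fin (m + k))} (hB : B.card = m) (σ : Equiv.Perm (Fin k))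

theorem card_compl_of_card_eq (hB : B.card = m) : Bᶜ.card = k := by
  rw [Finset.card_compl, hB, Fintype.card_fin, Nat.add_sub_cancel_left]

theorem shuffle_castAdd (i : Fin m) :
    shuffle B hB σ (Fin.castAdd k i) = B.orderEmbOfFin hB i := by
  simp [shuffle]

theorem shuffle_natAdd (i : Fin k) :
    shuffle B hB σ (Fin.natAdd m i) = Bᶜ.orderEmbOfFin (card_compl_of_card_eq hB) (σ i) := by
  simp [shuffle]

theorem sum_orderEmbOfFin {α M : Type*} [LinearOrder α] [AddCommMonoid M] (s : Finset α) {r : ℕ}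
    (hs : s.card = r) (f : α → M) : ∑ i, f (s.orderEmbOfFin hs i) = ∑ c ∈ s, f c := by
  conv_rhs => rw [← Finset.map_orderEmbOfFin_univ s hs, Finset.sum_map]
  rfl

/-- Pairs in the first block are in order, pairs in the second are inverted as in `σ` because `Bᶜ`
is enumerated increasingly, and a mixed pair is inverted when its element of `B` is the larger one.
-/
theorem inversions_shuffle : inversions (shuffle B hB σ) =
    (∑ c ∈ B, ∑ b ∈ Bᶜ, if b < c then 1 else 0) + inversions σ := by
  rw [inversions, Fin.sum_univ_add]
  simp only [Fin.sum_univ_add, shuffle_castAdd, shuffle_natAdd]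
  have h1 : ∀ i j : Fin m, ¬ (Fin.castAdd k i < Fin.castAdd k j ∧
      B.orderEmbOfFin hB j < B.orderEmbOfFin hB i) := by
    rintro i j ⟨h, h'⟩
    exact lt_asymm h (Fin.lt_def.2 (by simpa using h'))
  have h2 : ∀ (i : Fin k) (j : Fin m), ¬ Fin.natAdd m i < Fin.castAdd k j := by
    intro i j h
    have := Fin.lt_def.1 h
    simp at this
    omega
  have h3 : ∀ (i : Fin m) (j : Fin k), Fin.castAdd k i < Fin.natAdd m j := by
    intro i j
    rw [Fin.lt_def]
    simp
    omega
  simp only [h1, h2, h3, if_false, Finset.sum_const_zero, zero_add, true_and, false_and]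
  congr 1
  · rw [← sum_orderEmbOfFin B hB]
    refine Finset.sum_congr rfl fun i _ => ?_
    rw [← sum_orderEmbOfFin Bᶜ (card_compl_of_card_eq hB)]
    exact Equiv.sum_comp σ fun j =>
      if Bᶜ.orderEmbOfFin (card_compl_of_card_eq hB) j < B.orderEmbOfFin hB i then 1 else 0
  · simp [inversions]

theorem isDescent_shuffle_add (j : ℕ) (hj : 1 ≤ j) :
    IsDescent (shuffle B hB σ) (m + j) ↔ IsDescent σ j := by
  have key : ∀ (h : j < k), (shuffle B hB σ ⟨m + j, by omega⟩ < shuffle B hB σ ⟨m + j - 1, by omega⟩ ↔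
      σ ⟨j, h⟩ < σ ⟨j - 1, by omega⟩) := by
    intro h
    have e1 : (⟨m + j, by omega⟩ : Fin (m + k)) = Fin.natAdd m ⟨j, h⟩ := rfl
    have e2 : (⟨m + j - 1, by omega⟩ : Fin (m + k)) = Fin.natAdd m ⟨j - 1, by omega⟩ := by
      ext
      simp
      omega
    rw [e1, e2, shuffle_natAdd, shuffle_natAdd, OrderEmbedding.lt_iff_lt]
  constructor
  · rintro ⟨⟨h1, h2⟩, h⟩
    exact ⟨⟨hj, by omega⟩, (key (by omega)).1 h⟩
  · rintro ⟨⟨h1, h2⟩, h⟩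
    exact ⟨⟨by omega, by omega⟩, (key h2).2 h⟩

theorem not_isDescent_shuffle (j : ℕ) (hj : j < m) : ¬ IsDescent (shuffle B hB σ) j := by
  rintro ⟨⟨h1, h2⟩, h⟩
  have e1 : (⟨j, h2⟩ : Fin (m + k)) = Fin.castAdd k ⟨j, hj⟩ := rfl
  have e2 : (⟨j - 1, by omega⟩ : Fin (m + k)) = Fin.castAdd k ⟨j - 1, by omega⟩ := rfl
  rw [e1, e2, shuffle_castAdd, shuffle_castAdd, OrderEmbedding.lt_iff_lt, Fin.lt_def] at h
  simp at h
  omega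

theorem map_shuffle_univ : (Finset.univ : Finset (Fin m)).map
    ((Fin.castAddEmb k).trans (shuffle B hB σ).toEmbedding) = B := by
  conv_rhs => rw [← Finset.map_orderEmbOfFin_univ B hB]
  congr 1
  ext i
  simp [shuffle_castAdd]

/-- Take for `B` the values on the first `m` letters; `w` increases there, so it enumerates `B` in
order. Undoing the enumerations of `B` and `Bᶜ` leaves a permutation fixing the first summand
pointwise, hence acting on the second by some `σ`. -/
theorem exists_shuffle_eq (w : Equiv.Perm (Fin (m + k))) (hw : ∀ j < m, ¬ IsDescent w j) :
    ∃ (B : Finset (Fin (m + k))) (hB : B.card = m) (σ : Equiv.Perm (Fin k)),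
      shuffle B hB σ = w := by
  have hmono := strictMono_of_forall_not_isDescent (Nat.le_add_right m k) hw
  set B := (Finset.univ : Finset (Fin m)).map
    ((Fin.castAddEmb k).trans w.toEmbedding) with hBdef
  have hB : B.card = m := by simp [hBdef]
  have h1 : ∀ i, w (Fin.castAdd k i) = B.orderEmbOfFin hB i := by
    refine fun i => congrFun (Finset.orderEmbOfFin_unique hB (fun x => ?_) hmono) i
    rw [hBdef]
    simp only [Finset.mem_map, Finset.mem_univ, true_and]
    exact ⟨x, rfl⟩
  set e := finSumEquivOfFinset hB (card_compl_of_card_eq hB) with he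
  let u : Equiv.Perm (Fin m ⊕ Fin k) := finSumFinEquiv.trans (w.trans e.symm)
  have hu : ∀ i, u (Sum.inl i) = Sum.inl i := by
    intro i
    simp only [u, Equiv.trans_apply, finSumFinEquiv_apply_left, h1]
    rw [Equiv.symm_apply_eq]
    rfl
  have hr : u ∈ (Equiv.Perm.sumCongrHom (Fin m) (Fin k)).range := by
    apply Equiv.Perm.mem_sumCongrHom_range_of_perm_mapsTo_inl
    rintro _ ⟨i, rfl⟩
    exact ⟨i, (hu i).symm⟩
  obtain ⟨⟨τ, σ⟩, hσ⟩ := hr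
  refine ⟨B, hB, σ, ?_⟩
  ext1 x
  obtain ⟨y, rfl⟩ := finSumFinEquiv.surjective x
  rcases y with i | i
  · rw [finSumFinEquiv_apply_left, shuffle_castAdd, h1]
  · have : u (Sum.inr i) = Sum.inr (σ i) := by rw [← hσ]; rfl
    simp only [u, Equiv.trans_apply, Equiv.symm_apply_eq] at this
    rw [this, finSumFinEquiv_apply_right, shuffle_natAdd]
    rfl

end Shuffle

end SymmetricGroup

section Igusa

variable {K : Type*} [Field K]

theorem qMultinomial_insert (Y : K) (n k : ℕ) {I : Finset ℕ} (hI : ∀ i ∈ I, i < k) :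
    qMultinomial Y n (insert k I) = qBinomial Y n k * qMultinomial Y k I := by
  rw [qMultinomial, Finset.sort_insert _ (fun b hb => (hI b hb).le)
    (fun h => lt_irrefl _ (hI k h)), qMultinomialList, qMultinomial]

end Igusa

namespace SymmetricGroup

variable {K : Type*} [Field K]

open Classical in
/-- The generating function of the length over the permutations `w` such that `n - j` lies
in `I` for every descent `j` of `w`. -/
noncomputable def descentSum (Y : K) (n : ℕ) (I : Finset ℕ) : K :=
  ∑ w : Equiv.Perm (Fin n) with ∀ j, IsDescent w j → n - j ∈ I, Y ^ inversions w

theorem shuffle_injective {m k : ℕ} {B B' : Finset (Fin (m + k))} {hB : B.card = m}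
    {hB' : B'.card = m} {σ σ' : Equiv.Perm (Fin k)} (h : shuffle B hB σ = shuffle B' hB' σ') :
    B = B' ∧ σ = σ' := by
  have h1 : B = B' := by
    rw [← map_shuffle_univ hB σ, ← map_shuffle_univ hB' σ', h]
  subst h1
  refine ⟨rfl, Equiv.ext fun i => ?_⟩
  have := congrArg (fun w : Equiv.Perm _ => w (Fin.natAdd m i)) h
  simpa [shuffle_natAdd] using this

/-- As `k` is the largest allowed value of `n - j` with `n = m + k`, there is no descent before `m`,
while a descent at `m` itself is unconstrained. Such permutations are exactly the shuffles, on which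
inversions add up and later descents are those of `σ`. -/
theorem descentSum_insert {Y : K} (hY : ∀ j, 1 ≤ j → Y ^ j ≠ 1) (m k : ℕ) (I : Finset ℕ)
    (hI : ∀ i ∈ I, i < k) :
    descentSum Y (m + k) (insert k I) = qBinomial Y (m + k) k * descentSum Y k I := by
  classical
  rw [← sum_powersetCard_fin hY, descentSum, descentSum, Finset.sum_mul_sum,
    ← Finset.sum_product']
  symm
  refine Finset.sum_bij (fun p hp => shuffle p.1
    (Finset.mem_powersetCard.1 (Finset.mem_product.1 hp).1).2 p.2) ?_ ?_ ?_ ?_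
  · rintro ⟨B, σ⟩ hp
    have hB := (Finset.mem_powersetCard.1 (Finset.mem_product.1 hp).1).2
    have hσ := (Finset.mem_filter.1 (Finset.mem_product.1 hp).2).2
    refine Finset.mem_filter.2 ⟨Finset.mem_univ _, fun j hj => ?_⟩
    rcases lt_trichotomy j m with h | h | h
    · exact absurd hj (not_isDescent_shuffle hB σ j h)
    · rw [h, Nat.add_sub_cancel_left]
      exact Finset.mem_insert_self _ _
    · obtain ⟨i, rfl⟩ := Nat.exists_eq_add_of_le h.le
      rw [isDescent_shuffle_add hB σ i (by omega)] at hj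
      rw [Nat.add_sub_add_left]
      exact Finset.mem_insert_of_mem (hσ i hj)
  · rintro ⟨B, σ⟩ hp ⟨B', σ'⟩ hp' h
    obtain ⟨rfl, rfl⟩ := shuffle_injective h
    rfl
  · intro w hw
    have hw := (Finset.mem_filter.1 hw).2
    have hm : ∀ j < m, ¬ IsDescent w j := by
      intro j hj hd
      rcases Finset.mem_insert.1 (hw j hd) with h | h
      · omega
      · have := hI _ h
        omega
    obtain ⟨B, hB, σ, rfl⟩ := exists_shuffle_eq w hm
    refine ⟨⟨B, σ⟩, Finset.mem_product.2 ⟨Finset.mem_powersetCard.2 ⟨Finset.subset_univ _, hB⟩,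
      Finset.mem_filter.2 ⟨Finset.mem_univ _, fun j hj => ?_⟩⟩, rfl⟩
    have := hw (m + j) ((isDescent_shuffle_add hB σ j hj.1.1).2 hj)
    rw [Nat.add_sub_add_left] at this
    refine (Finset.mem_insert.1 this).resolve_left ?_
    have := hj.1
    omega
  · rintro ⟨B, σ⟩ hp
    rw [inversions_shuffle, pow_add]

theorem qMultinomial_eq_descentSum {Y : K} (hY : ∀ j, 1 ≤ j → Y ^ j ≠ 1) (I : Finset ℕ) (n : ℕ)
    (hI : ∀ i ∈ I, i ≤ n) : qMultinomial Y n I = descentSum Y n I := by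
  classical
  induction I using Finset.induction_on_max generalizing n with
  | empty =>
    have : (Finset.univ.filter fun w : Equiv.Perm (Fin n) =>
        ∀ j, IsDescent w j → n - j ∈ (∅ : Finset ℕ)) = {1} := by
      ext w
      simp only [Finset.mem_filter, Finset.mem_univ, true_and, Finset.mem_singleton,
        Finset.notMem_empty, imp_false]
      refine ⟨eq_one_of_forall_not_isDescent, ?_⟩
      rintro rfl j ⟨hj, h⟩
      have := Fin.lt_def.1 h
      simp at this
      omega
    rw [descentSum, this]
    simp [inversions_one, qMultinomial, qMultinomialList]
  | insert k I hk ih =>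
    obtain ⟨m, rfl⟩ := Nat.exists_eq_add_of_le' (hI k (Finset.mem_insert_self _ _))
    rw [descentSum_insert hY m k I hk, ← ih k fun i hi => (hk i hi).le,
      qMultinomial_insert Y _ k hk]

theorem prod_descents_eq {n : ℕ} (w : Equiv.Perm (Fin n)) (f : ℕ → K) :
    ∏ j ∈ descents w, f (n - j) = ∏ i ∈ (descents w).image (n - ·), f i := by
  rw [Finset.prod_image]
  intro i hi j hj h
  have h1 := (mem_descents.1 hi).1
  have h2 := (mem_descents.1 hj).1
  simp only at h
  omega

theorem image_descents_subset {n : ℕ} (w : Equiv.Perm (Fin n)) :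
    (descents w).image (n - ·) ⊆ Finset.Ico 1 n := by
  intro i hi
  obtain ⟨j, hj, rfl⟩ := Finset.mem_image.1 hi
  have := (mem_descents.1 hj).1
  rw [Finset.mem_Ico]
  omega

end SymmetricGroup

/-! ### Igusa functions: sum over the symmetric group and recursion -/

section

variable {K : Type*} [Field K]

/-- Expand the product over `S` of `X i + 0` for `i ∈ D` and `X i + (1 - X i)` for `i ∉ D`: only
subsets containing `D` survive, and the factors outside `D` equal `1`. -/
theorem sum_powerset_prod_of_subset {S D : Finset ℕ} (hD : D ⊆ S) (X : ℕ → K) :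
    ∑ I ∈ S.powerset, (if D ⊆ I then (∏ i ∈ I, X i) * ∏ i ∈ S \ I, (1 - X i) else 0) =
      ∏ i ∈ D, X i := by
  have h := Finset.prod_add X (fun i => if i ∈ D then 0 else 1 - X i) S
  have h1 : ∏ i ∈ S, (X i + if i ∈ D then 0 else 1 - X i) = ∏ i ∈ D, X i := by
    rw [← Finset.prod_subset hD (f := fun i => X i + if i ∈ D then 0 else 1 - X i)]
    · exact Finset.prod_congr rfl fun i hi => by simp [hi]
    · intro i _ hi
      simp [hi]
  rw [← h1, h]
  refine Finset.sum_congr rfl fun I hI => ?_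
  split_ifs with hDI
  · congr 1
    refine Finset.prod_congr rfl fun i hi => ?_
    rw [if_neg fun h => (Finset.mem_sdiff.1 hi).2 (hDI h)]
  · obtain ⟨i, hi, hi'⟩ := Finset.not_subset.1 hDI
    rw [Finset.prod_eq_zero (Finset.mem_sdiff.2 ⟨hD hi, hi'⟩) (by simp [hi]), mul_zero]

/-- The Igusa sum over subsets, cleared of denominators, as a sum over the symmetric group. -/
theorem sum_qMultinomial_mul_prod {Y : K} (hY : ∀ j, 1 ≤ j → Y ^ j ≠ 1) (n : ℕ) {X : ℕ → K}
    (hX : ∀ i ∈ Finset.Ico 1 n, 1 - X i ≠ 0) :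
    (∑ I ∈ (Finset.Ico 1 n).powerset, qMultinomial Y n I * ∏ i ∈ I, X i / (1 - X i)) *
        ∏ i ∈ Finset.Ico 1 n, (1 - X i) =
      ∑ w : Equiv.Perm (Fin n), Y ^ SymmetricGroup.length w *
        ∏ j ∈ SymmetricGroup.descents w, X (n - j) := by
  classical
  rw [Finset.sum_mul]
  have h1 : ∀ I ∈ (Finset.Ico 1 n).powerset,
      qMultinomial Y n I * (∏ i ∈ I, X i / (1 - X i)) * ∏ i ∈ Finset.Ico 1 n, (1 - X i) =
      ∑ w : Equiv.Perm (Fin n), Y ^ SymmetricGroup.length w *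
        if (SymmetricGroup.descents w).image (n - ·) ⊆ I then
          (∏ i ∈ I, X i) * ∏ i ∈ Finset.Ico 1 n \ I, (1 - X i) else 0 := by
    intro I hI
    have hI := Finset.mem_powerset.1 hI
    have h2 : (∏ i ∈ I, X i / (1 - X i)) * ∏ i ∈ Finset.Ico 1 n, (1 - X i) =
        (∏ i ∈ I, X i) * ∏ i ∈ Finset.Ico 1 n \ I, (1 - X i) := by
      rw [← Finset.prod_sdiff hI, mul_comm (∏ i ∈ _ \ I, _), ← mul_assoc, ← Finset.prod_mul_distrib]
      congr 1
      exact Finset.prod_congr rfl fun i hi => div_mul_cancel₀ _ (hX i (hI hi))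
    rw [mul_assoc, h2, SymmetricGroup.qMultinomial_eq_descentSum hY I n fun i hi =>
      (Finset.mem_Ico.1 (hI hi)).2.le, SymmetricGroup.descentSum, Finset.sum_filter, Finset.sum_mul]
    refine Finset.sum_congr rfl fun w _ => ?_
    have h3 : (SymmetricGroup.descents w).image (n - ·) ⊆ I ↔
        ∀ j, SymmetricGroup.IsDescent w j → n - j ∈ I := by
      simp only [Finset.image_subset_iff, SymmetricGroup.mem_descents]
    simp only [h3, SymmetricGroup.length_eq_inversions]
    split_ifs <;> simp
  -- After the exchange, a fixed `w` collects all `I` containing its reflected descent set, and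
  -- their contributions add up to a single monomial.
  rw [Finset.sum_congr rfl h1, Finset.sum_comm]
  refine Finset.sum_congr rfl fun w _ => ?_
  rw [← Finset.mul_sum, sum_powerset_prod_of_subset (SymmetricGroup.image_descents_subset w),
    SymmetricGroup.prod_descents_eq]

theorem igusa_eq_sum_perm {Y : K} (hY : ∀ j, 1 ≤ j → Y ^ j ≠ 1) {n : ℕ} (hn : 1 ≤ n) {X : ℕ → K}
    (hX : ∀ i ∈ Finset.Icc 1 n, 1 - X i ≠ 0) :
    igusa n Y X * ∏ i ∈ Finset.Icc 1 n, (1 - X i) =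
      ∑ w : Equiv.Perm (Fin n), Y ^ SymmetricGroup.length w *
        ∏ j ∈ SymmetricGroup.descents w, X (n - j) := by
  rw [← sum_qMultinomial_mul_prod hY n fun i hi => hX i (Finset.Ico_subset_Icc_self hi), igusa,
    ← Finset.Ico_insert_right hn, Finset.prod_insert Finset.right_notMem_Ico]
  have := hX n (Finset.right_mem_Icc.2 hn)
  field_simp

theorem sum_powerset_Ico {M : Type*} [AddCommMonoid M] (f : Finset ℕ → M) (n : ℕ) :
    ∑ I ∈ (Finset.Ico 1 n).powerset, f I =
      f ∅ + ∑ k ∈ Finset.Ico 1 n, ∑ I ∈ (Finset.Ico 1 k).powerset, f (insert k I) := by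
  induction n with
  | zero => simp
  | succ n ih =>
    rcases Nat.eq_zero_or_pos n with rfl | hn
    · simp
    · rw [← Finset.insert_Ico_right_eq_Ico_add_one hn, Finset.sum_powerset_insert (by simp),
        Finset.sum_insert (by simp), ih, add_assoc, add_comm (Finset.sum _ _)]

/-- The recursion for the Igusa functions by the largest element of the index set. -/
theorem one_sub_mul_igusa (Y : K) (n : ℕ) {X : ℕ → K} (hX : ∀ i ∈ Finset.Icc 1 n, 1 - X i ≠ 0)
    (hn : 1 ≤ n) :
    (1 - X n) * igusa n Y X =
      1 + ∑ k ∈ Finset.Ico 1 n, qBinomial Y n k * X k * igusa k Y X := by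
  have h1 : (1 - X n) * igusa n Y X =
      ∑ I ∈ (Finset.Ico 1 n).powerset, qMultinomial Y n I * ∏ i ∈ I, X i / (1 - X i) := by
    rw [igusa, ← mul_assoc, mul_one_div_cancel (hX n (Finset.right_mem_Icc.2 hn)), one_mul]
  rw [h1, sum_powerset_Ico]
  congr 1
  · simp [qMultinomial, qMultinomialList]
  refine Finset.sum_congr rfl fun k hk => ?_
  rw [igusa, ← mul_assoc, Finset.mul_sum]
  refine Finset.sum_congr rfl fun I hI => ?_
  have hI : ∀ i ∈ I, i < k := fun i hi => (Finset.mem_Ico.1 (Finset.mem_powerset.1 hI hi)).2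
  rw [qMultinomial_insert Y n k hI, Finset.prod_insert fun h => lt_irrefl _ (hI k h)]
  ring

end

/-! ### Lattices over a discrete valuation ring -/

section Exponent

open Module

variable {o : Type*} [CommRing o] [IsDomain o] {M : Type*} [AddCommGroup M] [Module o M]

/-- The least `e` such that `ϖ ^ e` annihilates the quotient by `L`. -/
noncomputable def exponent (ϖ : o) (L : Submodule o M) : ℕ :=
  sInf {e | ∀ v : M, ϖ ^ e • v ∈ L}

theorem pow_smul_mem_iff_of_diagonal_basis {ϖ : o} (hϖ : Irreducible ϖ) {n : ℕ}
    (b : Basis (Fin n) o M) (l : Fin n → ℕ) {L : Submodule o M}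
    (hL : ∀ v, v ∈ L ↔ ∀ j, ϖ ^ l j ∣ b.repr v j) (e : ℕ) :
    (∀ v : M, ϖ ^ e • v ∈ L) ↔ ∀ j, l j ≤ e := by
  constructor
  · intro h j
    have := (hL _).1 (h (b j)) j
    rw [map_smul, Finsupp.smul_apply, Basis.repr_self, Finsupp.single_eq_same, smul_eq_mul,
      mul_one] at this
    exact (pow_dvd_pow_iff hϖ.ne_zero hϖ.not_isUnit).1 this
  · intro h v
    rw [hL]
    intro j
    rw [map_smul, Finsupp.smul_apply, smul_eq_mul]
    exact Dvd.dvd.mul_right (pow_dvd_pow _ (h j)) _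

theorem exponent_eq_of_diagonal_basis {ϖ : o} (hϖ : Irreducible ϖ) {n : ℕ}
    (b : Basis (Fin n) o M) (l : Fin n → ℕ) {L : Submodule o M}
    (hL : ∀ v, v ∈ L ↔ ∀ j, ϖ ^ l j ∣ b.repr v j) : exponent ϖ L = Finset.univ.sup l := by
  simp only [exponent, pow_smul_mem_iff_of_diagonal_basis hϖ b l hL]
  refine le_antisymm (Nat.sInf_le fun j => Finset.le_sup (Finset.mem_univ j)) ?_
  exact le_csInf ⟨_, fun j => Finset.le_sup (f := l) (Finset.mem_univ j)⟩
    fun e he => Finset.sup_le fun j _ => he j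

end Exponent

section Lattices

open IsLocalRing Module

variable {o : Type*} [CommRing o] [IsDomain o] [IsDiscreteValuationRing o]
variable {M : Type*} [AddCommGroup M] [Module o M]

theorem infinite_of_isDiscreteValuationRing (o : Type*) [CommRing o] [IsDomain o]
    [IsDiscreteValuationRing o] : Infinite o := by
  by_contra h
  have := not_infinite_iff_finite.1 h
  exact IsDiscreteValuationRing.not_isField o (Finite.isField_of_domain o)

/-- This is the Smith normal form. The rank is full because otherwise some coordinate would vanish
on `L` and map the finite quotient onto the infinite ring `o`; the nonzero invariants are then
powers of `ϖ` up to units. -/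
theorem exists_diagonal_basis {ϖ : o} (hϖ : Irreducible ϖ) {n : ℕ} (b₀ : Basis (Fin n) o M)
    (L : Submodule o M) (hL : L.toAddSubgroup.index ≠ 0) :
    ∃ (b : Basis (Fin n) o M) (l : Fin n → ℕ), ∀ v, v ∈ L ↔ ∀ j, ϖ ^ l j ∣ b.repr v j := by
  obtain ⟨k, snf⟩ := L.smithNormalForm b₀
  have hsurj : Function.Surjective snf.f := by
    intro i
    by_contra hi
    have hle : L ≤ LinearMap.ker (snf.bM.coord i) := snf.le_ker_coord_of_notMem_range hi
    have hs : Function.Surjective (L.liftQ _ hle) := fun a =>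
      ⟨Submodule.Quotient.mk (a • snf.bM i), by simp⟩
    have : Finite (M ⧸ L) := Nat.finite_of_card_ne_zero hL
    have h1 := Finite.of_surjective _ hs
    have h2 := infinite_of_isDiscreteValuationRing o
    exact not_finite o
  let e : Fin k ≃ Fin n := Equiv.ofBijective snf.f ⟨snf.f.injective, hsurj⟩
  have ha : ∀ j, snf.a j ≠ 0 := by
    intro j hj
    apply snf.bN.ne_zero j
    ext
    rw [snf.snf j, hj]
    simp
  choose l hl using fun j => IsDiscreteValuationRing.associated_pow_irreducible (ha j) hϖ
  refine ⟨snf.bM, fun i => l (e.symm i), fun v => ?_⟩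
  have h1 : (∀ i, ϖ ^ l (e.symm i) ∣ snf.bM.repr v i) ↔ ∀ j, snf.a j ∣ snf.bM.repr v (snf.f j) := by
    rw [← e.forall_congr_right]
    refine forall_congr' fun j => ?_
    rw [Equiv.symm_apply_apply]
    exact (hl j).dvd_iff_dvd_left.symm
  rw [h1]
  constructor
  · intro hv j
    have := snf.repr_apply_embedding_eq_repr_smul ⟨v, hv⟩ (i := j)
    rw [map_smul] at this
    exact ⟨_, this⟩
  · intro h
    choose c hc using h
    rw [← snf.bM.sum_repr v, ← Equiv.sum_comp e]
    refine Submodule.sum_mem _ fun j _ => ?_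
    have : snf.bM.repr v (e j) • snf.bM (e j) = c j • (snf.bN j : M) := by
      rw [show e j = snf.f j from rfl, hc, snf.snf j, mul_comm, mul_smul]
    rw [this]
    exact L.smul_mem _ (snf.bN j).2

theorem card_levelRing (N : ℕ) :
    Nat.card (LevelRing o N) = Nat.card (ResidueField o) ^ N :=
  cardQuot_pow_of_prime (IsDiscreteValuationRing.not_a_field o)

theorem mk_levelRing_eq_zero_iff {ϖ : o} (hϖ : Irreducible ϖ) (N : ℕ) (a : o) :
    Ideal.Quotient.mk (maximalIdeal o ^ N) a = 0 ↔ ϖ ^ N ∣ a := by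
  rw [Ideal.Quotient.eq_zero_iff_mem, hϖ.maximalIdeal_eq, Ideal.span_singleton_pow,
    Ideal.mem_span_singleton]

theorem index_eq_of_diagonal_basis {ϖ : o} (hϖ : Irreducible ϖ) {n : ℕ} (b : Basis (Fin n) o M)
    (l : Fin n → ℕ) {L : Submodule o M} (hL : ∀ v, v ∈ L ↔ ∀ j, ϖ ^ l j ∣ b.repr v j) :
    L.toAddSubgroup.index = Nat.card (ResidueField o) ^ ∑ j, l j := by
  let f : M →ₗ[o] (∀ j, LevelRing o (l j)) :=
    LinearMap.pi fun j => (maximalIdeal o ^ l j).mkQ ∘ₗ b.coord j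
  have hf : Function.Surjective f := by
    intro y
    choose a ha using fun j => Ideal.Quotient.mk_surjective (y j)
    refine ⟨b.equivFun.symm a, ?_⟩
    funext j
    rw [← ha j]
    change Ideal.Quotient.mk _ (b.equivFun (b.equivFun.symm a) j) = _
    rw [LinearEquiv.apply_symm_apply]
  have hker : L = LinearMap.ker f := by
    ext v
    rw [hL, LinearMap.mem_ker, funext_iff]
    exact forall_congr' fun j => (mk_levelRing_eq_zero_iff hϖ _ _).symm
  have h1 : L.toAddSubgroup = f.toAddMonoidHom.ker := by rw [hker]; rfl
  have h2 : f.toAddMonoidHom.range = ⊤ := AddMonoidHom.range_eq_top.2 hf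
  rw [h1, AddSubgroup.index_ker, h2, AddSubgroup.card_top, Nat.card_pi, ← Finset.prod_pow_eq_pow_sum]
  exact Finset.prod_congr rfl fun j _ => card_levelRing _

theorem one_lt_card_residueField (o : Type*) [CommRing o] [IsLocalRing o]
    [Finite (ResidueField o)] : 1 < Nat.card (ResidueField o) :=
  Finite.one_lt_card

theorem exists_index_eq_pow {ϖ : o} (hϖ : Irreducible ϖ) {n : ℕ} (b₀ : Basis (Fin n) o M)
    (L : Submodule o M) (hL : L.toAddSubgroup.index ≠ 0) :
    ∃ m, L.toAddSubgroup.index = Nat.card (ResidueField o) ^ m :=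
  have ⟨b, l, h⟩ := exists_diagonal_basis hϖ b₀ L hL
  ⟨_, index_eq_of_diagonal_basis hϖ b l h⟩

section Finite

variable [Finite (ResidueField o)]

theorem pow_smul_mem_of_index_eq {ϖ : o} (hϖ : Irreducible ϖ) {n : ℕ} (b₀ : Basis (Fin n) o M)
    {L : Submodule o M} {m : ℕ} (hL : L.toAddSubgroup.index = Nat.card (ResidueField o) ^ m)
    (v : M) : ϖ ^ m • v ∈ L := by
  have hq := one_lt_card_residueField o
  obtain ⟨b, l, h⟩ := exists_diagonal_basis hϖ b₀ L (by rw [hL]; positivity)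
  rw [index_eq_of_diagonal_basis hϖ b l h] at hL
  have := Nat.pow_right_injective hq hL
  exact (pow_smul_mem_iff_of_diagonal_basis hϖ b l h m).2
    (fun j => this ▸ Finset.single_le_sum (fun _ _ => Nat.zero_le _) (Finset.mem_univ j)) v

theorem exponent_le {ϖ : o} (hϖ : Irreducible ϖ) {n : ℕ} (b₀ : Basis (Fin n) o M)
    {L : Submodule o M} {m : ℕ} (hL : L.toAddSubgroup.index = Nat.card (ResidueField o) ^ m) :
    exponent ϖ L ≤ m :=
  Nat.sInf_le (pow_smul_mem_of_index_eq hϖ b₀ hL)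

variable (o) in
/-- The submodules of `o ^ n` of index `q ^ m`, where `q` is the residue cardinality. -/
abbrev LatticeOfIndex (n m : ℕ) : Type _ :=
  {L : Submodule o (Fin n → o) // L.toAddSubgroup.index = Nat.card (ResidueField o) ^ m}

instance (N : ℕ) : Finite (LevelRing o N) :=
  Nat.finite_of_card_ne_zero (by
    rw [card_levelRing]
    exact (pow_pos (zero_lt_one.trans (one_lt_card_residueField o)) _).ne')

/-- Every such lattice contains `ϖ ^ m o ^ n`, so it is determined by its image in the finite module
`(o / 𝔭 ^ m) ^ n`. -/
instance (n m : ℕ) : Finite (LatticeOfIndex o n m) := by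
  obtain ⟨ϖ, hϖ⟩ := IsDiscreteValuationRing.exists_irreducible o
  let f : (Fin n → o) →ₗ[o] (Fin n → LevelRing o m) :=
    LinearMap.pi fun j => (maximalIdeal o ^ m).mkQ ∘ₗ LinearMap.proj j
  have hf : ∀ L : LatticeOfIndex o n m, LinearMap.ker f ≤ L.1 := by
    intro L v hv
    have h1 : ∀ j, ϖ ^ m ∣ v j := fun j =>
      (mk_levelRing_eq_zero_iff hϖ m (v j)).1 (congrFun (LinearMap.mem_ker.1 hv) j)
    choose c hc using h1
    have : v = ϖ ^ m • c := funext hc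
    rw [this]
    exact pow_smul_mem_of_index_eq hϖ (Pi.basisFun o (Fin n)) L.2 c
  refine Finite.of_injective (β := Set (Fin n → LevelRing o m))
    (fun L => (L.1.map f : Submodule o _)) fun L L' h => ?_
  ext1
  rw [← sup_eq_left.2 (hf L), ← sup_eq_left.2 (hf L'), ← Submodule.comap_map_eq,
    ← Submodule.comap_map_eq, SetLike.coe_injective h]

noncomputable instance (n m : ℕ) : Fintype (LatticeOfIndex o n m) := Fintype.ofFinite _

end Finite

end Lattices

/-! ### Lattices in a product with prescribed reduction -/

section GraphLattice

open IsLocalRing Module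

variable {o : Type*} [CommRing o] {A C : Type*} [AddCommGroup A] [Module o A]
  [AddCommGroup C] [Module o C]

/-- The pairs `(a, c)` such that `φ c` is the class of `a`. -/
def fiberProduct (L : Submodule o A) (φ : C →ₗ[o] A ⧸ L) : Submodule o (A × C) :=
  LinearMap.ker (L.mkQ ∘ₗ LinearMap.fst o A C - φ ∘ₗ LinearMap.snd o A C)

theorem mem_fiberProduct {L : Submodule o A} {φ : C →ₗ[o] A ⧸ L} {x : A × C} :
    x ∈ fiberProduct L φ ↔ L.mkQ x.1 = φ x.2 := by
  simp [fiberProduct, sub_eq_zero]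

theorem index_fiberProduct (L : Submodule o A) (φ : C →ₗ[o] A ⧸ L) :
    (fiberProduct L φ).toAddSubgroup.index = L.toAddSubgroup.index := by
  set f := L.mkQ ∘ₗ LinearMap.fst o A C - φ ∘ₗ LinearMap.snd o A C with hf
  have h1 : (fiberProduct L φ).toAddSubgroup = f.toAddMonoidHom.ker := rfl
  have h2 : f.toAddMonoidHom.range = ⊤ := by
    refine AddMonoidHom.range_eq_top.2 fun y => ?_
    obtain ⟨a, rfl⟩ := L.mkQ_surjective y
    exact ⟨(a, 0), by simp [hf]⟩
  rw [h1, AddSubgroup.index_ker, h2, AddSubgroup.card_top]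
  rfl

theorem fiberProduct_injective {L L' : Submodule o A} {φ : C →ₗ[o] A ⧸ L} {φ' : C →ₗ[o] A ⧸ L'}
    (h : fiberProduct L φ = fiberProduct L' φ') :
    (⟨L, φ⟩ : Σ L : Submodule o A, C →ₗ[o] A ⧸ L) = ⟨L', φ'⟩ := by
  have h1 : L = L' := by
    ext a
    have : (a, (0 : C)) ∈ fiberProduct L φ ↔ (a, (0 : C)) ∈ fiberProduct L' φ' := by rw [h]
    simpa [mem_fiberProduct] using this
  subst h1
  congr 1
  ext c
  obtain ⟨a, ha⟩ := L.mkQ_surjective (φ c)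
  have h2 : (a, c) ∈ fiberProduct L φ := mem_fiberProduct.2 ha
  rw [h, mem_fiberProduct] at h2
  exact ha.symm.trans h2

/-- The projection of `N` onto the projective module `C` has a section `s`. Take `L` to be the part
of `N` inside `A`, and `φ` the first component of `s` modulo `L`. -/
theorem exists_fiberProduct_eq [Module.Projective o C] (N : Submodule o (A × C))
    (hN : N.map (LinearMap.snd o A C) = ⊤) :
    ∃ (L : Submodule o A) (φ : C →ₗ[o] A ⧸ L), fiberProduct L φ = N := by
  have hs : Function.Surjective (LinearMap.snd o A C ∘ₗ N.subtype) := by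
    intro c
    obtain ⟨x, hx, rfl⟩ : c ∈ N.map (LinearMap.snd o A C) := hN ▸ Submodule.mem_top
    exact ⟨⟨x, hx⟩, rfl⟩
  obtain ⟨s, hs⟩ := Module.projective_lifting_property _ LinearMap.id hs
  have hs2 : ∀ c, (s c : A × C).2 = c := fun c => LinearMap.congr_fun hs c
  let L := N.comap (LinearMap.inl o A C)
  refine ⟨L, L.mkQ ∘ₗ LinearMap.fst o A C ∘ₗ N.subtype ∘ₗ s, ?_⟩
  ext ⟨a, c⟩
  have h1 : (a, c) - (s c : A × C) = (a - (s c : A × C).1, 0) := by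
    ext <;> simp [hs2]
  rw [mem_fiberProduct, LinearMap.comp_apply, ← sub_eq_zero, ← map_sub, Submodule.mkQ_apply,
    Submodule.Quotient.mk_eq_zero]
  change (a - (s c : A × C).1, 0) ∈ N ↔ _
  rw [← h1]
  exact N.sub_mem_iff_left (s c).2

/-- Multiplication of the first component by `ϖ`. -/
def scaleFst (ϖ : o) : A × C →ₗ[o] A × C :=
  LinearMap.prodMap (ϖ • LinearMap.id) LinearMap.id

@[simp]
theorem scaleFst_apply (ϖ : o) (x : A × C) : scaleFst ϖ x = (ϖ • x.1, x.2) := rfl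

/-- The pairs `(ϖ a, c)` such that `φ c` is the class of `a`. -/
def graphLattice (ϖ : o) (p : Σ L : Submodule o A, C →ₗ[o] A ⧸ L) : Submodule o (A × C) :=
  (fiberProduct p.1 p.2).map (scaleFst ϖ)

theorem graphLattice_sup (ϖ : o) (p : Σ L : Submodule o A, C →ₗ[o] A ⧸ L) :
    graphLattice ϖ p ⊔ LinearMap.range (ϖ • LinearMap.id : A × C →ₗ[o] A × C) =
      LinearMap.range (scaleFst ϖ : A × C →ₗ[o] A × C) := by
  refine le_antisymm (sup_le LinearMap.map_le_range ?_) ?_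
  · rintro _ ⟨⟨a, c⟩, rfl⟩
    exact ⟨(a, ϖ • c), by simp⟩
  · rintro _ ⟨⟨a, c⟩, rfl⟩
    obtain ⟨a', ha'⟩ := p.1.mkQ_surjective (p.2 c)
    have h1 : scaleFst ϖ (a, c) = scaleFst ϖ (a', c) + ϖ • (a - a', (0 : C)) := by
      simp [← smul_add]
    rw [h1]
    exact Submodule.add_mem_sup ⟨_, mem_fiberProduct.2 ha', rfl⟩ ⟨(a - a', 0), rfl⟩

/-- Divide the first component by `ϖ`. The hypothesis says that the result projects onto `C` modulo
the maximal ideal, hence onto `C` by Nakayama, and `exists_fiberProduct_eq` applies. -/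
theorem exists_graphLattice_eq [IsLocalRing o] [Module.Projective o C] [Module.Finite o C] {ϖ : o}
    (hϖ : ϖ ∈ maximalIdeal o) (N : Submodule o (A × C))
    (hN : N ⊔ LinearMap.range (ϖ • LinearMap.id : A × C →ₗ[o] A × C) =
      LinearMap.range (scaleFst ϖ : A × C →ₗ[o] A × C)) :
    ∃ p, graphLattice ϖ p = N := by
  have hle : N ≤ LinearMap.range (scaleFst ϖ : A × C →ₗ[o] A × C) := hN ▸ le_sup_left
  have hmap : (N.comap (scaleFst ϖ)).map (LinearMap.snd o A C) = ⊤ := by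
    have h1 : (⊤ : Submodule o C) ≤
        (N.comap (scaleFst ϖ)).map (LinearMap.snd o A C) ⊔ maximalIdeal o • ⊤ := by
      rintro c -
      have h2 : ((0 : A), c) ∈ N ⊔ LinearMap.range (ϖ • LinearMap.id : A × C →ₗ[o] A × C) := by
        rw [hN]
        exact ⟨(0, c), by simp⟩
      obtain ⟨x, hx, _, ⟨y, rfl⟩, hxy⟩ := Submodule.mem_sup.1 h2
      obtain ⟨z, rfl⟩ := hle hx
      have h3 : z.2 + ϖ • y.2 = c := (Prod.ext_iff.1 hxy).2
      rw [← h3]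
      exact Submodule.add_mem_sup ⟨z, hx, rfl⟩ (Submodule.smul_mem_smul hϖ Submodule.mem_top)
    exact top_le_iff.1 (Submodule.le_of_le_smul_of_le_jacobson_bot Module.Finite.fg_top
      (IsLocalRing.jacobson_eq_maximalIdeal ⊥ bot_ne_top).ge h1)
  obtain ⟨L, φ, h⟩ := exists_fiberProduct_eq _ hmap
  refine ⟨⟨L, φ⟩, ?_⟩
  rw [graphLattice, h, Submodule.map_comap_eq, inf_eq_right.2 hle]

theorem index_map_toAddSubgroup {M M' : Type*} [AddCommGroup M] [Module o M] [AddCommGroup M']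
    [Module o M'] {f : M →ₗ[o] M'} (hf : Function.Injective f) (N : Submodule o M) :
    (N.map f).toAddSubgroup.index =
      N.toAddSubgroup.index * (LinearMap.range f).toAddSubgroup.index := by
  have h : (N.map f).toAddSubgroup = N.toAddSubgroup.map f.toAddMonoidHom := by
    ext
    rfl
  rw [h, AddSubgroup.index_map_of_injective (f := f.toAddMonoidHom) _ hf]
  rfl

variable [IsDomain o] [IsTorsionFree o A]

theorem scaleFst_injective {ϖ : o} (hϖ : ϖ ≠ 0) :
    Function.Injective (scaleFst ϖ : A × C →ₗ[o] A × C) := by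
  rintro ⟨a, c⟩ ⟨a', c'⟩ h
  obtain ⟨h1, h2⟩ := Prod.ext_iff.1 h
  ext
  · exact smul_right_injective A hϖ h1
  · exact h2

theorem graphLattice_injective {ϖ : o} (hϖ : ϖ ≠ 0) :
    Function.Injective (graphLattice (A := A) (C := C) ϖ) := fun _ _ h =>
  fiberProduct_injective (Submodule.map_injective_of_injective (scaleFst_injective hϖ) h)

theorem index_graphLattice {ϖ : o} (hϖ : ϖ ≠ 0) (p : Σ L : Submodule o A, C →ₗ[o] A ⧸ L) :
    (graphLattice ϖ p).toAddSubgroup.index = p.1.toAddSubgroup.index *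
      (LinearMap.range (scaleFst ϖ : A × C →ₗ[o] A × C)).toAddSubgroup.index := by
  rw [← index_fiberProduct p.1 p.2, graphLattice, index_map_toAddSubgroup (scaleFst_injective hϖ)]

/-- Since `(ϖ ^ (e + 1) a, 0)` is the image of `(ϖ ^ e a, 0)` under `scaleFst`, one extra power of
`ϖ` is needed; the second component costs no more, because `φ` is killed by whatever kills `A / L`.
The hypothesis `hA` excludes exponent `0`. -/
theorem exponent_graphLattice {ϖ : o} (hϖ : ϖ ≠ 0) (hA : ∃ a : A, ∀ a' : A, ϖ • a' ≠ a)
    (p : Σ L : Submodule o A, C →ₗ[o] A ⧸ L) (hp : ∃ e : ℕ, ∀ a : A, ϖ ^ e • a ∈ p.1) :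
    exponent ϖ (graphLattice ϖ p) = exponent ϖ p.1 + 1 := by
  have h0 : ¬ ∀ v : A × C, ϖ ^ 0 • v ∈ graphLattice ϖ p := by
    intro h
    obtain ⟨a, ha⟩ := hA
    obtain ⟨x, -, hx⟩ := h (a, 0)
    rw [pow_zero, one_smul] at hx
    exact ha x.1 (Prod.ext_iff.1 hx).1
  have h1 : ∀ e, (∀ v : A × C, ϖ ^ (e + 1) • v ∈ graphLattice ϖ p) ↔
      ∀ a : A, ϖ ^ e • a ∈ p.1 := by
    intro e
    constructor
    · intro h a
      obtain ⟨x, hx, hx'⟩ := h (a, 0)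
      obtain ⟨h2, h3⟩ := Prod.ext_iff.1 hx'
      have hx := mem_fiberProduct.1 hx
      simp only [scaleFst_apply, Prod.smul_mk, smul_zero] at h2 h3
      rw [pow_succ', mul_smul] at h2
      rw [smul_right_injective A hϖ h2, h3, map_zero] at hx
      exact (Submodule.Quotient.mk_eq_zero _).1 hx
    · rintro h ⟨a, c⟩
      refine ⟨(ϖ ^ e • a, ϖ ^ (e + 1) • c), mem_fiberProduct.2 ?_, ?_⟩
      · obtain ⟨a', ha'⟩ := p.1.mkQ_surjective (p.2 c)
        simp only [map_smul]
        rw [← map_smul, ← ha', ← map_smul, Submodule.mkQ_apply, Submodule.mkQ_apply,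
          (Submodule.Quotient.mk_eq_zero _).2 (h a), pow_succ', mul_smul,
          (Submodule.Quotient.mk_eq_zero _).2 (p.1.smul_mem _ (h a'))]
      · rw [scaleFst_apply, Prod.smul_mk, smul_smul, ← pow_succ']
  -- Nonemptiness matters: the infimum of the empty set would be the default value `0`.
  have hs : {e | ∀ v : A × C, ϖ ^ e • v ∈ graphLattice ϖ p}.Nonempty :=
    hp.imp' (· + 1) fun e he => (h1 e).2 he
  refine le_antisymm (Nat.sInf_le ((h1 _).2 (Nat.sInf_mem hp))) ?_
  obtain ⟨e, he⟩ : ∃ e, exponent ϖ (graphLattice ϖ p) = e + 1 := by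
    refine Nat.exists_eq_succ_of_ne_zero fun h => h0 ?_
    rw [← h]
    exact Nat.sInf_mem hs
  rw [he]
  refine Nat.succ_le_succ (Nat.sInf_le ((h1 e).1 ?_))
  rw [← he]
  exact Nat.sInf_mem hs

end GraphLattice

/-! ### Counting lattices by their reduction -/

section Recursion

open IsLocalRing Module

variable {o : Type*} [CommRing o]

theorem index_map_equiv {M M' : Type*} [AddCommGroup M] [Module o M] [AddCommGroup M'] [Module o M']
    (e : M ≃ₗ[o] M') (L : Submodule o M) :
    (L.map (e : M →ₗ[o] M')).toAddSubgroup.index = L.toAddSubgroup.index := by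
  rw [index_map_toAddSubgroup e.injective, LinearEquiv.range]
  simp

theorem exponent_map_equiv {M M' : Type*} [AddCommGroup M] [Module o M] [AddCommGroup M']
    [Module o M'] [IsDomain o] (ϖ : o) (e : M ≃ₗ[o] M') (L : Submodule o M) :
    exponent ϖ (L.map (e : M →ₗ[o] M')) = exponent ϖ L := by
  have : ∀ k, (∀ v : M', ϖ ^ k • v ∈ L.map (e : M →ₗ[o] M')) ↔ ∀ v : M, ϖ ^ k • v ∈ L := by
    intro k
    rw [e.surjective.forall]
    refine forall_congr' fun v => ?_
    rw [← map_smul, Submodule.mem_map_equiv, LinearEquiv.symm_apply_apply]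
  simp only [exponent, this]

theorem mem_range_scaleFst {i k : ℕ} (ϖ : o) (x : (Fin i → o) × (Fin k → o)) :
    x ∈ LinearMap.range (scaleFst ϖ : (Fin i → o) × (Fin k → o) →ₗ[o] _) ↔ ∀ j, ϖ ∣ x.1 j := by
  constructor
  · rintro ⟨y, rfl⟩ j
    exact ⟨y.1 j, rfl⟩
  · intro h
    choose c hc using h
    exact ⟨(c, x.2), Prod.ext (funext fun j => (hc j).symm) rfl⟩

theorem card_linearMap_quotient (i k : ℕ) (L : Submodule o (Fin i → o)) :
    Nat.card ((Fin k → o) →ₗ[o] (Fin i → o) ⧸ L) = L.toAddSubgroup.index ^ k := by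
  rw [← Nat.card_congr ((Pi.basisFun o (Fin k)).constr ℕ).toEquiv, Nat.card_fun]
  simp
  rfl

/-- Reduction of vectors modulo the maximal ideal. -/
noncomputable def reduction (o : Type*) [CommRing o] [IsLocalRing o] (n : ℕ) :
    (Fin n → o) →ₛₗ[residue o] (Fin n → ResidueField o) where
  toFun v j := residue o (v j)
  map_add' v w := by ext; simp
  map_smul' a v := by ext; simp

theorem reduction_surjective (o : Type*) [CommRing o] [IsLocalRing o] (n : ℕ) :
    Function.Surjective (reduction o n) := by
  intro w
  choose v hv using fun j => residue_surjective (R := o) (w j)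
  exact ⟨v, funext hv⟩

instance (o : Type*) [CommRing o] [IsLocalRing o] : RingHomSurjective (residue o) :=
  ⟨residue_surjective⟩

variable [IsDomain o] [IsDiscreteValuationRing o]

theorem ker_reduction {ϖ : o} (hϖ : Irreducible ϖ) (n : ℕ) :
    LinearMap.ker (reduction o n) =
      LinearMap.range (ϖ • LinearMap.id : (Fin n → o) →ₗ[o] (Fin n → o)) := by
  ext v
  have h : ∀ j, residue o (v j) = 0 ↔ ϖ ∣ v j := fun j => by
    rw [residue_eq_zero_iff, hϖ.maximalIdeal_eq, Ideal.mem_span_singleton]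
  rw [LinearMap.mem_ker, LinearMap.mem_range, funext_iff]
  constructor
  · intro hv
    choose c hc using fun j => (h j).1 (hv j)
    exact ⟨c, funext fun j => (hc j).symm⟩
  · rintro ⟨c, rfl⟩ j
    exact (h j).2 ⟨c j, rfl⟩

/-- `L` reduces to `W` exactly when `L + ϖ o ^ n` is the preimage of `W`. In adapted coordinates
this is the condition characterising graph lattices in `graphLattice_sup` and
`exists_graphLattice_eq`. -/
theorem map_reduction_eq_iff {ϖ : o} (hϖ : Irreducible ϖ) {i k : ℕ}
    {W : Submodule (ResidueField o) (Fin (i + k) → ResidueField o)}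
    {e : (Fin (i + k) → o) ≃ₗ[o] (Fin i → o) × (Fin k → o)}
    (he : (W.comap (reduction o (i + k))).map
      (e : (Fin (i + k) → o) →ₗ[o] (Fin i → o) × (Fin k → o)) = LinearMap.range (scaleFst ϖ))
    (L : Submodule o (Fin (i + k) → o)) :
    L.map (reduction o (i + k)) = W ↔
      L.map (e : (Fin (i + k) → o) →ₗ[o] (Fin i → o) × (Fin k → o)) ⊔
        LinearMap.range (ϖ • LinearMap.id) = LinearMap.range (scaleFst ϖ) := by
  have h1 : (LinearMap.ker (reduction o (i + k))).map
      (e : (Fin (i + k) → o) →ₗ[o] (Fin i → o) × (Fin k → o)) =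
      LinearMap.range (ϖ • LinearMap.id) := by
    rw [ker_reduction hϖ]
    ext x
    constructor
    · rintro ⟨_, ⟨v, rfl⟩, rfl⟩
      exact ⟨e v, by simp⟩
    · rintro ⟨y, rfl⟩
      exact ⟨_, ⟨e.symm y, rfl⟩, by simp⟩
  rw [← h1, ← he, ← Submodule.map_sup, ← Submodule.comap_map_eq,
    (Submodule.map_injective_of_injective e.injective).eq_iff,
    (Submodule.comap_injective_of_surjective (reduction_surjective o (i + k))).eq_iff]

theorem index_comap_reduction {i k : ℕ}
    (W : Submodule (ResidueField o) (Fin (i + k) → ResidueField o)) (hW : finrank (ResidueField o) W = k) :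
    (W.comap (reduction o (i + k))).toAddSubgroup.index = Nat.card (ResidueField o) ^ i := by
  have h1 : (W.comap (reduction o (i + k))).toAddSubgroup =
      W.toAddSubgroup.comap (reduction o (i + k)).toAddMonoidHom := rfl
  rw [h1, AddSubgroup.index_comap_of_surjective _ (reduction_surjective o (i + k))]
  have h2 : W.toAddSubgroup.index = Nat.card ((Fin (i + k) → ResidueField o) ⧸ W) := rfl
  have h3 := W.finrank_quotient_add_finrank
  rw [Module.finrank_fin_fun, hW] at h3
  rw [h2, Module.natCard_eq_pow_finrank (K := ResidueField o), Nat.add_right_cancel h3]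

theorem index_range_scaleFst {ϖ : o} {i k : ℕ}
    {W : Submodule (ResidueField o) (Fin (i + k) → ResidueField o)}
    (hW : finrank (ResidueField o) W = k)
    {e : (Fin (i + k) → o) ≃ₗ[o] (Fin i → o) × (Fin k → o)}
    (he : (W.comap (reduction o (i + k))).map
      (e : (Fin (i + k) → o) →ₗ[o] (Fin i → o) × (Fin k → o)) = LinearMap.range (scaleFst ϖ)) :
    (LinearMap.range (scaleFst ϖ : (Fin i → o) × (Fin k → o) →ₗ[o] _)).toAddSubgroup.index =
      Nat.card (ResidueField o) ^ i := by
  rw [← he, index_map_equiv, index_comap_reduction W hW]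

variable [Finite (ResidueField o)]

/-- Coordinates adapted to a subspace of the reduction. -/
theorem exists_equiv_prod {ϖ : o} (hϖ : Irreducible ϖ) {i k : ℕ}
    (W : Submodule (ResidueField o) (Fin (i + k) → ResidueField o)) (hW : finrank (ResidueField o) W = k) :
    ∃ e : (Fin (i + k) → o) ≃ₗ[o] (Fin i → o) × (Fin k → o),
      (W.comap (reduction o (i + k))).map (e : (Fin (i + k) → o) →ₗ[o] (Fin i → o) × (Fin k → o)) =
        LinearMap.range (scaleFst ϖ) := by
  have hq := one_lt_card_residueField o
  have hidx := index_comap_reduction W hW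
  obtain ⟨b, l, hb⟩ := exists_diagonal_basis hϖ (Pi.basisFun o (Fin (i + k)))
    (W.comap (reduction o (i + k))) (by rw [hidx]; positivity)
  rw [index_eq_of_diagonal_basis hϖ b l hb] at hidx
  have hsum : ∑ j, l j = i := Nat.pow_right_injective hq hidx
  -- The preimage of `W` contains `ϖ o ^ n`, so its elementary divisors are `1` or `ϖ`; its index `q
  -- ^ i` says that `ϖ` occurs `i` times.
  have hl : ∀ j, l j ≤ 1 := by
    refine (pow_smul_mem_iff_of_diagonal_basis hϖ b l hb 1).1 fun v => ?_
    have : ϖ ^ 1 • v ∈ LinearMap.ker (reduction o (i + k)) := by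
      rw [ker_reduction hϖ, pow_one]
      exact ⟨v, rfl⟩
    rw [Submodule.mem_comap, LinearMap.mem_ker.1 this]
    exact W.zero_mem
  let S : Finset (Fin (i + k)) := {j | l j = 1}
  have hl' : ∀ j, l j = if j ∈ S then 1 else 0 := by
    intro j
    have := hl j
    simp only [S, Finset.mem_filter, Finset.mem_univ, true_and]
    split_ifs <;> omega
  have hS : S.card = i := by
    refine Eq.trans ?_ hsum
    rw [Finset.sum_congr rfl fun j _ => hl' j]
    simp
  have hS' : Sᶜ.card = k := SymmetricGroup.card_compl_of_card_eq hS
  let e := b.equivFun ≪≫ₗ LinearEquiv.funCongrLeft o o (finSumEquivOfFinset hS hS') ≪≫ₗ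
    LinearEquiv.sumArrowLequivProdArrow (Fin i) (Fin k) o o
  refine ⟨e, ?_⟩
  ext x
  obtain ⟨v, rfl⟩ := e.surjective x
  rw [mem_range_scaleFst, Submodule.mem_map_equiv, LinearEquiv.symm_apply_apply, hb,
    ← (finSumEquivOfFinset hS hS').forall_congr_right, Sum.forall]
  have h1 : ∀ c, ϖ ^ l (finSumEquivOfFinset hS hS' (Sum.inr c)) ∣
      b.repr v (finSumEquivOfFinset hS hS' (Sum.inr c)) := by
    intro c
    rw [hl', if_neg]
    · simp
    · rw [finSumEquivOfFinset_inr]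
      exact Finset.mem_compl.1 (Finset.orderEmbOfFin_mem _ _ _)
  have h2 : ∀ a, l (finSumEquivOfFinset hS hS' (Sum.inl a)) = 1 := by
    intro a
    rw [hl', if_pos]
    rw [finSumEquivOfFinset_inl]
    exact Finset.orderEmbOfFin_mem _ _ _
  rw [and_iff_left h1]
  refine forall_congr' fun a => ?_
  rw [h2, pow_one]
  rfl

/-- The sum of `u ^ exponent L` over the lattices `L` in `o ^ n` of index `q ^ m`. -/
noncomputable def latticeSum {K : Type*} [Field K] (ϖ : o) (n m : ℕ) (u : K) : K :=
  ∑ L : LatticeOfIndex o n m, u ^ exponent ϖ L.1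

/-- This parametrises the lattices over a fixed `W` by graph data `(L, φ)`. The index is multiplied
by `q ^ i`, the index of the preimage of `W`. -/
theorem exists_bijective_graphLattice {ϖ : o} (hϖ : Irreducible ϖ) {i k : ℕ} (m : ℕ)
    {W : Submodule (ResidueField o) (Fin (i + k) → ResidueField o)}
    (hW : finrank (ResidueField o) W = k)
    {e : (Fin (i + k) → o) ≃ₗ[o] (Fin i → o) × (Fin k → o)}
    (he : (W.comap (reduction o (i + k))).map
      (e : (Fin (i + k) → o) →ₗ[o] (Fin i → o) × (Fin k → o)) = LinearMap.range (scaleFst ϖ)) :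
    ∃ f : (Σ L : LatticeOfIndex o i m, (Fin k → o) →ₗ[o] (Fin i → o) ⧸ L.1) →
      {L : LatticeOfIndex o (i + k) (m + i) // L.1.map (reduction o (i + k)) = W},
      Function.Bijective f ∧ ∀ p, (f p).1.1 = (graphLattice ϖ ⟨p.1.1, p.2⟩).map
        (e.symm : (Fin i → o) × (Fin k → o) →ₗ[o] (Fin (i + k) → o)) := by
  have hidx := index_range_scaleFst hW he
  have hq := one_lt_card_residueField o
  have hmap : ∀ N : Submodule o ((Fin i → o) × (Fin k → o)),
      (N.map (e.symm : (Fin i → o) × (Fin k → o) →ₗ[o] (Fin (i + k) → o))).map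
        (e : (Fin (i + k) → o) →ₗ[o] (Fin i → o) × (Fin k → o)) = N := by
    intro N
    ext x
    simp [Submodule.mem_map_equiv]
  refine ⟨fun p => ⟨⟨(graphLattice ϖ ⟨p.1.1, p.2⟩).map
    (e.symm : (Fin i → o) × (Fin k → o) →ₗ[o] (Fin (i + k) → o)), ?_⟩, ?_⟩, ⟨?_, ?_⟩, fun p => rfl⟩
  · rw [index_map_equiv, index_graphLattice hϖ.ne_zero, hidx, p.1.2, pow_add]
  · rw [map_reduction_eq_iff hϖ he, hmap, graphLattice_sup]
  · intro p p' h
    have h1 := congrArg (fun L => L.1.1.map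
      (e : (Fin (i + k) → o) →ₗ[o] (Fin i → o) × (Fin k → o))) h
    simp only [hmap] at h1
    have h2 := graphLattice_injective hϖ.ne_zero h1
    obtain ⟨⟨L, hL⟩, φ⟩ := p
    obtain ⟨⟨L', hL'⟩, φ'⟩ := p'
    cases h2
    rfl
  · rintro ⟨⟨L, hL⟩, hLW⟩
    obtain ⟨⟨N, φ⟩, hp⟩ := exists_graphLattice_eq (by
      rw [hϖ.maximalIdeal_eq]
      exact Ideal.mem_span_singleton_self ϖ) _ ((map_reduction_eq_iff hϖ he L).1 hLW)
    have hN : N.toAddSubgroup.index = Nat.card (ResidueField o) ^ m := by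
      have h1 := index_graphLattice hϖ.ne_zero ⟨N, φ⟩
      rw [hp, index_map_equiv, hL, hidx, pow_add] at h1
      exact (Nat.eq_of_mul_eq_mul_right (by positivity) h1).symm
    refine ⟨⟨⟨N, hN⟩, φ⟩, ?_⟩
    ext1
    ext1
    change (graphLattice ϖ ⟨N, φ⟩).map _ = L
    rw [hp]
    ext x
    simp [Submodule.mem_map_equiv]

theorem le_of_map_reduction_eq {i k m : ℕ}
    {W : Submodule (ResidueField o) (Fin (i + k) → ResidueField o)}
    (hW : finrank (ResidueField o) W = k) (L : LatticeOfIndex o (i + k) m)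
    (hL : L.1.map (reduction o (i + k)) = W) : i ≤ m := by
  have h1 : L.1 ≤ W.comap (reduction o (i + k)) := by
    rw [← hL]
    exact Submodule.le_comap_map _ _
  have h2 := AddSubgroup.index_dvd_of_le (H := L.1.toAddSubgroup)
    (K := (W.comap (reduction o (i + k))).toAddSubgroup) fun _ hx => h1 hx
  rw [index_comap_reduction W hW, L.2] at h2
  exact (Nat.pow_dvd_pow_iff_le_right (one_lt_card_residueField o)).1 h2

/-- In the bijection with pairs `(L', φ)`, where `L'` has index `q ^ (m - i)`, the factor `u` comes
from the exponent growing by one, and the power of `q` counts the `φ`. For `i = 0` the exponent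
would not grow, hence `1 ≤ i`. -/
theorem sum_fiber_reduction {K : Type*} [Field K] {ϖ : o} (hϖ : Irreducible ϖ) {i k : ℕ}
    (hi : 1 ≤ i) (m : ℕ) (u : K) (W : Submodule (ResidueField o) (Fin (i + k) → ResidueField o))
    (hW : finrank (ResidueField o) W = k)
    [Fintype {L : LatticeOfIndex o (i + k) m // L.1.map (reduction o (i + k)) = W}] :
    ∑ L : {L : LatticeOfIndex o (i + k) m // L.1.map (reduction o (i + k)) = W},
        u ^ exponent ϖ L.1.1 =
      if i ≤ m then u * (Nat.card (ResidueField o) : K) ^ (k * (m - i)) *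
        latticeSum ϖ i (m - i) u else 0 := by
  split_ifs with him
  · obtain ⟨m, rfl⟩ := Nat.exists_eq_add_of_le' him
    rw [Nat.add_sub_cancel]
    obtain ⟨e, he⟩ := exists_equiv_prod hϖ W hW
    obtain ⟨f, hf, hf'⟩ := exists_bijective_graphLattice hϖ m hW he
    have hq := one_lt_card_residueField o
    have hcard : ∀ L : LatticeOfIndex o i m, Nat.card ((Fin k → o) →ₗ[o] (Fin i → o) ⧸ L.1) =
        Nat.card (ResidueField o) ^ (k * m) := by
      intro L
      rw [card_linearMap_quotient, L.2, ← pow_mul, mul_comm]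
    have hfin : ∀ L : LatticeOfIndex o i m, Finite ((Fin k → o) →ₗ[o] (Fin i → o) ⧸ L.1) :=
      fun L => Nat.finite_of_card_ne_zero (by rw [hcard]; positivity)
    have hfin' : ∀ L : LatticeOfIndex o i m, Fintype ((Fin k → o) →ₗ[o] (Fin i → o) ⧸ L.1) :=
      fun L => Fintype.ofFinite _
    have hA : ∃ a : Fin i → o, ∀ a' : Fin i → o, ϖ • a' ≠ a := by
      refine ⟨fun _ => 1, fun a' h => hϖ.not_isUnit ?_⟩
      exact IsUnit.of_mul_eq_one _ (congrFun h ⟨0, hi⟩)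
    have hexp : ∀ p, exponent ϖ (f p).1.1 = exponent ϖ p.1.1 + 1 := by
      intro p
      rw [hf', exponent_map_equiv]
      exact exponent_graphLattice hϖ.ne_zero hA _
        ⟨m, pow_smul_mem_of_index_eq hϖ (Pi.basisFun o (Fin i)) p.1.2⟩
    rw [← Function.Bijective.sum_comp hf, Fintype.sum_sigma, latticeSum, Finset.mul_sum]
    refine Finset.sum_congr rfl fun L _ => ?_
    simp only [hexp]
    rw [Finset.sum_const, Finset.card_univ, ← Nat.card_eq_fintype_card, hcard, nsmul_eq_mul]
    push_cast
    ring
  · have : IsEmpty {L : LatticeOfIndex o (i + k) m // L.1.map (reduction o (i + k)) = W} :=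
      ⟨fun L => him (le_of_map_reduction_eq hW L.1 L.2)⟩
    exact Finset.sum_of_isEmpty _

end Recursion

/-! ### Counting subspaces over a finite field -/

section Grassmannian

open Module

variable (F : Type*) [Field F] [Finite F]

/-- Linearly independent `d`-tuples in the whole space are fibred over their spans, and each fibre
consists of the bases of a `d`-dimensional space. -/
theorem card_subspaces_mul (n d : ℕ) (hd : d ≤ n) :
    Nat.card {W : Submodule F (Fin n → F) // finrank F W = d} *
        ∏ j : Fin d, (Nat.card F ^ d - Nat.card F ^ (j : ℕ)) =
      ∏ j : Fin d, (Nat.card F ^ n - Nat.card F ^ (j : ℕ)) := by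
  classical
  have := Fintype.ofFinite F
  let T := {s : Fin d → Fin n → F // LinearIndependent F s}
  let G := {W : Submodule F (Fin n → F) // finrank F W = d}
  let g : T → G := fun s => ⟨Submodule.span F (Set.range s.1), by
    rw [finrank_span_eq_card s.2, Fintype.card_fin]⟩
  have hmem : ∀ (W : G) (s : {s : T // g s = W}) (j : Fin d), s.1.1 j ∈ W.1 := by
    rintro W ⟨s, rfl⟩ j
    exact Submodule.subset_span ⟨j, rfl⟩
  have hspan : ∀ (W : G) (t : {t : Fin d → W.1 // LinearIndependent F t})
      (h : LinearIndependent F fun j => (t.1 j : Fin n → F)), g ⟨_, h⟩ = W := by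
    intro W t h
    refine Subtype.ext (Submodule.eq_of_le_of_finrank_eq ?_ ?_)
    · rw [Submodule.span_le]
      rintro _ ⟨j, rfl⟩
      exact (t.1 j).2
    · rw [(g ⟨_, h⟩).2, W.2]
  have hfib : ∀ W : G, Nat.card {s : T // g s = W} =
      ∏ j : Fin d, (Nat.card F ^ d - Nat.card F ^ (j : ℕ)) := by
    intro W
    have h1 := card_linearIndependent (K := F) (V := W.1) (k := d) W.2.ge
    rw [W.2, ← Nat.card_eq_fintype_card] at h1
    rw [← h1]
    refine Nat.card_congr
      { toFun := fun s => ⟨fun j => ⟨s.1.1 j, hmem W s j⟩, ?_⟩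
        invFun := fun t => ⟨⟨fun j => t.1 j, ?_⟩, hspan W t _⟩
        left_inv := fun s => rfl
        right_inv := fun t => rfl }
    · exact LinearIndependent.of_comp W.1.subtype s.1.2
    · exact t.2.map' W.1.subtype (Submodule.ker_subtype _)
  have h2 := card_linearIndependent (K := F) (V := Fin n → F) (k := d) (by simpa using hd)
  rw [Module.finrank_fin_fun, ← Nat.card_eq_fintype_card] at h2
  have := Fintype.ofFinite G
  have := Fintype.ofFinite T
  rw [← h2, ← Nat.card_congr (Equiv.sigmaFiberEquiv g), Nat.card_sigma,
    Finset.sum_congr rfl fun W _ => hfib W, Finset.sum_const, Finset.card_univ,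
    Nat.card_eq_fintype_card (α := G), smul_eq_mul]

theorem natCast_inv_pow_ne_one {K : Type*} [Field K] [CharZero K] {q : ℕ} (hq : 1 < q) (j : ℕ)
    (hj : 1 ≤ j) : ((q : K)⁻¹) ^ j ≠ 1 := by
  rw [inv_pow, Ne, inv_eq_one, ← Nat.cast_pow]
  exact_mod_cast (Nat.one_lt_pow (by omega) hq).ne'

theorem prod_pow_sub_pow {K : Type*} [Field K] {q : K} (hq : q ≠ 0) (i d : ℕ) :
    (∏ j : Fin d, (q ^ (i + d) - q ^ (j : ℕ))) * qFactorial q⁻¹ i =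
      q ^ (i * d) * (q ^ d) ^ d * qFactorial q⁻¹ (i + d) := by
  have h1 : qFactorial q⁻¹ (i + d) =
      qFactorial q⁻¹ i * ∏ j ∈ Finset.range d, (1 - q⁻¹ ^ (i + d - j)) := by
    rw [qFactorial, Finset.prod_range_add, ← qFactorial, ← Finset.prod_range_reflect]
    congr 1
    refine Finset.prod_congr rfl fun j hj => ?_
    have := Finset.mem_range.1 hj
    congr 2
    omega
  have h2 : ∏ j : Fin d, (q ^ (i + d) - q ^ (j : ℕ)) =
      q ^ (i * d) * (q ^ d) ^ d * ∏ j ∈ Finset.range d, (1 - q⁻¹ ^ (i + d - j)) := by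
    rw [Fin.prod_univ_eq_prod_range (fun j => q ^ (i + d) - q ^ j), pow_mul, ← mul_pow, ← pow_add,
      ← Finset.card_range d, ← Finset.prod_const, Finset.card_range, ← Finset.prod_mul_distrib]
    refine Finset.prod_congr rfl fun j hj => ?_
    have := Finset.mem_range.1 hj
    have h3 : q ^ (i + d) = q ^ (i + d - j) * q ^ j := by rw [← pow_add]; congr 1; omega
    rw [mul_sub, mul_one, h3, mul_right_comm, ← mul_pow, mul_inv_cancel₀ hq, one_pow, one_mul]
  rw [h1, h2]
  ring

theorem card_subspaces {K : Type*} [Field K] [CharZero K] (i d : ℕ) :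
    (Nat.card {W : Submodule F (Fin (i + d) → F) // finrank F W = d} : K) =
      (Nat.card F : K) ^ (i * d) * qBinomial (Nat.card F : K)⁻¹ (i + d) i := by
  have hq : 1 < Nat.card F := Finite.one_lt_card
  have hY := natCast_inv_pow_ne_one (K := K) hq
  have hq0 : (Nat.card F : K) ≠ 0 := by
    have : Nat.card F ≠ 0 := by omega
    exact_mod_cast this
  have hcast : ∀ n, d ≤ n → ((∏ j : Fin d, (Nat.card F ^ n - Nat.card F ^ (j : ℕ)) : ℕ) : K) =
      ∏ j : Fin d, ((Nat.card F : K) ^ n - (Nat.card F : K) ^ (j : ℕ)) := by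
    intro n hn
    rw [Nat.cast_prod]
    refine Finset.prod_congr rfl fun j _ => ?_
    rw [Nat.cast_sub (Nat.pow_le_pow_right hq.le (by omega)), Nat.cast_pow, Nat.cast_pow]
  have h := congrArg (Nat.cast : ℕ → K) (card_subspaces_mul F (i + d) d (by omega))
  rw [Nat.cast_mul, hcast _ le_rfl, hcast _ (by omega)] at h
  have h1 := prod_pow_sub_pow hq0 i d
  have h2 := prod_pow_sub_pow hq0 0 d
  rw [zero_add, zero_mul, pow_zero, one_mul, show qFactorial (Nat.card F : K)⁻¹ 0 = 1 from
    Finset.prod_range_zero _, mul_one] at h2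
  rw [h2] at h
  rw [← h] at h1
  have h4 := qBinomial_eq hY d i
  rw [add_comm d i] at h4
  rw [h4, ← mul_div_assoc, eq_div_iff (mul_ne_zero (qFactorial_ne_zero hY d)
    (qFactorial_ne_zero hY i))]
  have h3 : ((Nat.card F : K) ^ d) ^ d ≠ 0 := pow_ne_zero _ (pow_ne_zero _ hq0)
  refine mul_left_cancel₀ h3 ?_
  linear_combination h1

end Grassmannian

/-! ### The recursion for the lattice sums -/

section Recursion

open IsLocalRing Module

variable {o : Type*} [CommRing o] [IsDomain o] [IsDiscreteValuationRing o]

theorem eq_top_of_map_reduction_eq_top {n : ℕ} {L : Submodule o (Fin n → o)}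
    (hL : L.map (reduction o n) = ⊤) : L = ⊤ := by
  obtain ⟨ϖ, hϖ⟩ := IsDiscreteValuationRing.exists_irreducible o
  refine top_le_iff.1 (Submodule.le_of_le_smul_of_le_jacobson_bot (I := maximalIdeal o)
    Module.Finite.fg_top (IsLocalRing.jacobson_eq_maximalIdeal ⊥ bot_ne_top).ge ?_)
  have h1 := Submodule.comap_map_eq (reduction o n) L
  rw [hL, Submodule.comap_top, ker_reduction hϖ] at h1
  refine h1.le.trans (sup_le_sup_left ?_ _)
  rintro _ ⟨v, rfl⟩
  refine Submodule.smul_mem_smul ?_ Submodule.mem_top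
  rw [hϖ.maximalIdeal_eq]
  exact Ideal.mem_span_singleton_self ϖ

variable [Finite (ResidueField o)] {K : Type*} [Field K]

theorem latticeSum_zero_right {ϖ : o} (hϖ : Irreducible ϖ) (n : ℕ) (u : K) :
    latticeSum ϖ n 0 u = 1 := by
  have h1 : ∀ L : LatticeOfIndex o n 0, u ^ exponent ϖ L.1 = 1 := by
    intro L
    rw [Nat.le_zero.1 (exponent_le hϖ (Pi.basisFun o (Fin n)) L.2), pow_zero]
  have h2 : Fintype.card (LatticeOfIndex o n 0) = 1 := by
    rw [Fintype.card_eq_one_iff]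
    refine ⟨⟨⊤, by simp⟩, fun L => Subtype.ext ?_⟩
    have := AddSubgroup.index_eq_one.1 (L.2.trans (pow_zero _))
    ext v
    have h : v ∈ L.1.toAddSubgroup ↔ v ∈ (⊤ : AddSubgroup _) := by rw [this]
    simpa using h
  simp [latticeSum, h1, h2]

/-- Lattices are grouped by the codimension `i` of their reduction. The class `i = 0` is empty: by
Nakayama it could only contain the full module, of index `1 ≠ q ^ m`. -/
theorem latticeSum_eq_sum [CharZero K] {ϖ : o} (hϖ : Irreducible ϖ) (n m : ℕ) (hm : 1 ≤ m) (u : K) :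
    latticeSum ϖ n m u = ∑ i ∈ Finset.Icc 1 n, (Nat.card (ResidueField o) : K) ^ (i * (n - i)) *
      qBinomial (Nat.card (ResidueField o) : K)⁻¹ n i *
        if i ≤ m then u * (Nat.card (ResidueField o) : K) ^ ((n - i) * (m - i)) *
          latticeSum ϖ i (m - i) u else 0 := by
  classical
  have := Fintype.ofFinite (Submodule (ResidueField o) (Fin n → ResidueField o))
  have hle : ∀ W : Submodule (ResidueField o) (Fin n → ResidueField o),
      finrank (ResidueField o) W ≤ n := fun W => W.finrank_le.trans_eq (Module.finrank_fin_fun _)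
  rw [latticeSum, ← Fintype.sum_fiberwise (fun L : LatticeOfIndex o n m => L.1.map (reduction o n)),
    ← Finset.sum_fiberwise_of_maps_to (s := Finset.univ) (t := Finset.range (n + 1))
      (g := fun W : Submodule (ResidueField o) (Fin n → ResidueField o) =>
        n - finrank (ResidueField o) W)
      (fun W _ => Finset.mem_range.2 (by omega)),
    Finset.range_eq_Ico, Finset.sum_eq_sum_Ico_succ_bot (by omega), Finset.sum_eq_zero, zero_add]
  · refine Finset.sum_congr (by ext; simp) fun i hi => ?_
    have hi := Finset.mem_Ico.1 hi
    obtain ⟨k, rfl⟩ := Nat.exists_eq_add_of_le (show i ≤ n by omega)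
    have h1 : ∀ W ∈ Finset.univ.filter (fun W : Submodule (ResidueField o)
        (Fin (i + k) → ResidueField o) => i + k - finrank (ResidueField o) W = i),
        ∑ L : {L : LatticeOfIndex o (i + k) m // L.1.map (reduction o (i + k)) = W},
          u ^ exponent ϖ L.1.1 = _ := fun W hW =>
      sum_fiber_reduction hϖ hi.1 m u W (by
        have h1 := (Finset.mem_filter.1 hW).2
        have h2 := hle W
        omega)
    rw [Finset.sum_congr rfl h1, Finset.sum_const, nsmul_eq_mul, Nat.add_sub_cancel_left,
      ← card_subspaces, Nat.subtype_card]
    intro W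
    have := hle W
    simp
    omega
  · intro W hW
    have hW := (Finset.mem_filter.1 hW).2
    have htop : W = ⊤ := Submodule.eq_top_of_finrank_eq (by
      rw [Module.finrank_fin_fun]
      have := hle W
      omega)
    have : IsEmpty {L : LatticeOfIndex o n m // L.1.map (reduction o n) = W} := by
      refine ⟨fun L => ?_⟩
      have h1 := L.1.2
      rw [eq_top_of_map_reduction_eq_top (L.2.trans htop)] at h1
      have h2 := Nat.one_lt_pow (by omega : m ≠ 0) (one_lt_card_residueField o)
      rw [← h1] at h2
      simp at h2
    exact Finset.sum_of_isEmpty _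

end Recursion

/-! ### A `q`-binomial identity -/

section QIdentity

/-- The number of `d`-dimensional subspaces of a space of dimension `i + d` over a field with `q`
elements. -/
noncomputable def subspaceCount (K : Type*) [Field K] (q i d : ℕ) : K :=
  (q : K) ^ (i * d) * qBinomial (q : K)⁻¹ (i + d) i

theorem subspaceCount_zero_left {K : Type*} [Field K] (q d : ℕ) : subspaceCount K q 0 d = 1 := by
  simp [subspaceCount, qBinomial_zero_right]

variable {K : Type*} [Field K] [CharZero K]

theorem subspaceCount_zero_right {q : ℕ} (hq : 1 < q) (i : ℕ) : subspaceCount K q i 0 = 1 := by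
  simp [subspaceCount, qBinomial_self (natCast_inv_pow_ne_one hq)]

theorem subspaceCount_succ_succ {q : ℕ} (hq : 1 < q) (i d : ℕ) :
    subspaceCount K q (i + 1) (d + 1) =
      subspaceCount K q (i + 1) d + (q : K) ^ (d + 1) * subspaceCount K q i (d + 1) := by
  have hq0 : (q : K) ≠ 0 := by exact_mod_cast (by omega : q ≠ 0)
  have h := qBinomial_pascal (natCast_inv_pow_ne_one (K := K) hq) d i
  rw [show d + 1 + (i + 1) = i + 1 + (d + 1) by ring, show d + 1 + i = i + (d + 1) by ring,
    show d + (i + 1) = i + 1 + d by ring] at h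
  have h1 : (q : K) ^ (i + 1) * (q : K)⁻¹ ^ (i + 1) = 1 := by
    rw [← mul_pow, mul_inv_cancel₀ hq0, one_pow]
  simp only [subspaceCount]
  rw [h, mul_add, add_comm]
  congr 1
  · linear_combination (q : K) ^ ((i + 1) * d) * qBinomial (q : K)⁻¹ (i + 1 + d) (i + 1) * h1
  · ring

/-- The two halves `f₁`, `f₂` of the Pascal recursion, set to zero on the boundary, both shift back
to the antidiagonal of `n`. There they recombine through `(1 - q ^ d x) + q ^ d x = 1`. -/
theorem sum_subspaceCount_mul_prod {q : ℕ} (hq : 1 < q) {A : Type*} [CommRing A] [Algebra K A]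
    (x : A) (n : ℕ) :
    ∑ p ∈ Finset.HasAntidiagonal.antidiagonal n, algebraMap K A (subspaceCount K q p.1 p.2) * x ^ p.1 *
      ∏ j ∈ Finset.range p.2, (1 - (q : A) ^ j * x) = 1 := by
  induction n with
  | zero => simp [subspaceCount_zero_left]
  | succ n ih =>
    let P : ℕ → A := fun d => ∏ j ∈ Finset.range d, (1 - (q : A) ^ j * x)
    let f₁ : ℕ × ℕ → A := fun p => match p with
      | (_, 0) => 0
      | (i, d + 1) => algebraMap K A (subspaceCount K q i d) * x ^ i * P (d + 1)
    let f₂ : ℕ × ℕ → A := fun p => match p with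
      | (0, _) => 0
      | (i + 1, d) => algebraMap K A (subspaceCount K q i d) * (q : A) ^ d * x ^ (i + 1) * P d
    have hf : ∀ p ∈ Finset.HasAntidiagonal.antidiagonal (n + 1), algebraMap K A (subspaceCount K q p.1 p.2) *
        x ^ p.1 * ∏ j ∈ Finset.range p.2, (1 - (q : A) ^ j * x) = f₁ p + f₂ p := by
      rintro ⟨_ | i, _ | d⟩ hp
      · simp at hp
      · simp [f₁, f₂, subspaceCount_zero_left, P]
      · simp [f₁, f₂, subspaceCount_zero_right hq, P]
      · simp only [f₁, f₂, subspaceCount_succ_succ hq, map_add, map_mul, map_pow, map_natCast, P]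
        ring
    rw [Finset.sum_congr rfl hf, Finset.sum_add_distrib, Finset.Nat.sum_antidiagonal_succ',
      Finset.Nat.sum_antidiagonal_succ (f := f₂), ← ih]
    simp only [f₁, f₂, zero_add]
    rw [← Finset.sum_add_distrib]
    refine Finset.sum_congr rfl fun p _ => ?_
    have hP : P (p.2 + 1) = P p.2 * (1 - (q : A) ^ p.2 * x) := Finset.prod_range_succ _ _
    rw [hP]
    ring

end QIdentity

/-! ### Generating series of lattices -/

section LatticeSeries

open IsLocalRing PowerSeries

variable {o : Type*} [CommRing o] [IsDomain o] [IsDiscreteValuationRing o]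
  [Finite (ResidueField o)] {K : Type*} [Field K]

/-- The generating series `∑_L c ^ len L * u ^ exponent L * X ^ len L` over the lattices `L`
in `o ^ n`. -/
noncomputable def latticeSeries (ϖ : o) (n : ℕ) (c u : K) : K⟦X⟧ :=
  PowerSeries.mk fun m => c ^ m * latticeSum ϖ n m u

variable [CharZero K]

/-- The parameter `c` is what makes the recursion close up: the number `q ^ ((n - i)(m - i))` of
maps `φ` is absorbed by replacing `c` with `q ^ (n - i) c`. -/
theorem latticeSeries_eq {ϖ : o} (hϖ : Irreducible ϖ) (n : ℕ) (c u : K) :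
    latticeSeries ϖ n c u = 1 + ∑ i ∈ Finset.Icc 1 n,
      C (subspaceCount K (Nat.card (ResidueField o)) i (n - i) * u * c ^ i) * X ^ i *
        latticeSeries ϖ i ((Nat.card (ResidueField o) : K) ^ (n - i) * c) u := by
  ext m
  simp only [map_add, map_sum, mul_assoc, coeff_C_mul, coeff_X_pow_mul', latticeSeries, coeff_mk]
  rcases Nat.eq_zero_or_pos m with rfl | hm
  · rw [latticeSum_zero_right hϖ, Finset.sum_eq_zero]
    · simp
    · intro i hi
      have := (Finset.mem_Icc.1 hi).1
      rw [if_neg (by omega)]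
      ring
  · rw [latticeSum_eq_sum hϖ n m hm, coeff_one, if_neg (by omega), zero_add, Finset.mul_sum]
    refine Finset.sum_congr rfl fun i hi => ?_
    have hi := Finset.mem_Icc.1 hi
    rw [subspaceCount, Nat.add_sub_cancel' hi.2]
    split_ifs with h
    · have h1 : c ^ m = c ^ i * c ^ (m - i) := by rw [← pow_add, Nat.add_sub_cancel' h]
      rw [h1, mul_pow, ← pow_mul]
      ring
    · ring

theorem one_sub_C_mul_X_pow_ne_zero (a : K) {k : ℕ} (hk : 1 ≤ k) :
    (1 - C a * X ^ k : K⟦X⟧) ≠ 0 := by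
  intro h
  have := congrArg constantCoeff h
  rw [map_sub, map_mul, map_pow, constantCoeff_X, zero_pow (by omega)] at this
  simp at this

theorem one_sub_mul_latticeSeries {ϖ : o} (hϖ : Irreducible ϖ) {n : ℕ} (hn : 1 ≤ n) (c u : K) :
    (1 - C (u * c ^ n) * X ^ n) * latticeSeries ϖ n c u = 1 + ∑ i ∈ Finset.Ico 1 n,
      C (subspaceCount K (Nat.card (ResidueField o)) i (n - i) * u * c ^ i) * X ^ i *
        latticeSeries ϖ i ((Nat.card (ResidueField o) : K) ^ (n - i) * c) u := by
  have h := latticeSeries_eq hϖ n c u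
  rw [← Finset.Ico_insert_right hn, Finset.sum_insert Finset.right_notMem_Ico, Nat.sub_self,
    subspaceCount_zero_right (one_lt_card_residueField o), pow_zero, one_mul, one_mul] at h
  linear_combination h

/-- At `u = 1` the exponent is ignored and the series is the classical zeta function of `o ^ n`.
Multiplied by the full product, the recursion turns into `sum_subspaceCount_mul_prod`, whose terms
`i = 0` and `i = n` match the summand `1` and the factor `1 - c ^ n X ^ n`. -/
theorem latticeSeries_mul_prod {ϖ : o} (hϖ : Irreducible ϖ) (n : ℕ) (c : K) :
    latticeSeries ϖ n c 1 *
      ∏ j ∈ Finset.range n, (1 - (Nat.card (ResidueField o) : K⟦X⟧) ^ j * (C c * X)) = 1 := by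
  induction n using Nat.strong_induction_on generalizing c with
  | _ n ih =>
    rcases Nat.eq_zero_or_pos n with rfl | hn
    · rw [latticeSeries_eq hϖ]
      simp
    · refine mul_left_cancel₀ (one_sub_C_mul_X_pow_ne_zero (c ^ n) hn) ?_
      have hsum := sum_subspaceCount_mul_prod (K := K) (one_lt_card_residueField o)
        (C c * X : K⟦X⟧) n
      rw [Finset.Nat.sum_antidiagonal_eq_sum_range_succ_mk, Finset.sum_range_succ,
        Finset.range_eq_Ico, Finset.sum_eq_sum_Ico_succ_bot hn, Nat.sub_self, Nat.sub_zero,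
        subspaceCount_zero_right (one_lt_card_residueField o), subspaceCount_zero_left] at hsum
      have h := one_sub_mul_latticeSeries hϖ hn c (1 : K)
      rw [one_mul] at h
      rw [← mul_assoc, h, add_mul, one_mul, Finset.sum_mul]
      have h1 : ∀ i ∈ Finset.Ico 1 n,
          C (subspaceCount K (Nat.card (ResidueField o)) i (n - i) * 1 * c ^ i) * X ^ i *
            latticeSeries ϖ i ((Nat.card (ResidueField o) : K) ^ (n - i) * c) 1 *
            ∏ j ∈ Finset.range n, (1 - (Nat.card (ResidueField o) : K⟦X⟧) ^ j * (C c * X)) =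
          algebraMap K K⟦X⟧ (subspaceCount K (Nat.card (ResidueField o)) i (n - i)) *
            (C c * X) ^ i * ∏ j ∈ Finset.range (n - i),
              (1 - (Nat.card (ResidueField o) : K⟦X⟧) ^ j * (C c * X)) := by
        intro i hi
        have hi := Finset.mem_Ico.1 hi
        have h2 := ih i hi.2 ((Nat.card (ResidueField o) : K) ^ (n - i) * c)
        -- The last `i` factors form the product belonging to rank `i` and parameter `q ^ (n - i)
        -- c`, which the induction hypothesis cancels.
        have h3 : ∏ j ∈ Finset.range n, (1 - (Nat.card (ResidueField o) : K⟦X⟧) ^ j * (C c * X)) =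
            (∏ j ∈ Finset.range (n - i),
              (1 - (Nat.card (ResidueField o) : K⟦X⟧) ^ j * (C c * X))) *
            ∏ j ∈ Finset.range i, (1 - (Nat.card (ResidueField o) : K⟦X⟧) ^ j *
              (C ((Nat.card (ResidueField o) : K) ^ (n - i) * c) * X)) := by
          conv_lhs => rw [← Nat.sub_add_cancel hi.2.le, Finset.prod_range_add]
          congr 1
          refine Finset.prod_congr rfl fun j _ => ?_
          rw [pow_add, map_mul, map_pow, map_natCast]
          ring
        rw [h3, ← PowerSeries.algebraMap_eq, mul_one, map_mul, map_pow]
        rw [← PowerSeries.algebraMap_eq] at h2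
        linear_combination (algebraMap K K⟦X⟧
          (subspaceCount K (Nat.card (ResidueField o)) i (n - i)) * algebraMap K K⟦X⟧ c ^ i *
          X ^ i * ∏ j ∈ Finset.range (n - i), (1 - (Nat.card (ResidueField o) : K⟦X⟧) ^ j *
            (algebraMap K K⟦X⟧ c * X))) * h2
      rw [Finset.sum_congr rfl h1]
      simp only [map_one, one_mul, pow_zero, Finset.range_zero, Finset.prod_empty, mul_one,
        zero_add, mul_pow] at hsum ⊢
      rw [map_pow]
      linear_combination hsum

end LatticeSeries

/-! ### Lattice series as Igusa functions -/

section Igusa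

open IsLocalRing PowerSeries

theorem map_subspaceCount {K L : Type*} [Field K] [Field L] (f : K →+* L) (q i d : ℕ) :
    f (subspaceCount K q i d) = subspaceCount L q i d := by
  simp [subspaceCount, qBinomial, map_prod]

theorem igusa_congr {K : Type*} [Field K] (Y : K) {n : ℕ} (hn : 1 ≤ n) {X X' : ℕ → K}
    (h : ∀ i ∈ Finset.Icc 1 n, X i = X' i) : igusa n Y X = igusa n Y X' := by
  rw [igusa, igusa, h n (Finset.right_mem_Icc.2 hn)]
  congr 1
  refine Finset.sum_congr rfl fun I hI => ?_
  congr 1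
  refine Finset.prod_congr rfl fun i hi => ?_
  rw [h i (Finset.Ico_subset_Icc_self (Finset.mem_powerset.1 hI hi))]

variable {o : Type*} [CommRing o] [IsDomain o] [IsDiscreteValuationRing o]
  [Finite (ResidueField o)] {K : Type*} [Field K] [CharZero K]

theorem ofPowerSeries_one_sub_ne_zero (a : K) {k : ℕ} (hk : 1 ≤ k) :
    1 - HahnSeries.ofPowerSeries ℤ K (C a * X ^ k) ≠ 0 := by
  rw [← map_one (HahnSeries.ofPowerSeries ℤ K), ← map_sub]
  exact (map_ne_zero_iff _ HahnSeries.ofPowerSeries_injective).2 (one_sub_C_mul_X_pow_ne_zero a hk)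

/-- Both sides satisfy the recursion of `one_sub_mul_igusa`. Its arguments do not change when `(n,
c)` becomes `(i, q ^ (n - i) c)`, because `k (i - k) + (n - i) k = k (n - k)`; the remaining power
of `q` is the one in `subspaceCount`. -/
theorem ofPowerSeries_latticeSeries {ϖ : o} (hϖ : Irreducible ϖ) {n : ℕ} (hn : 1 ≤ n) (c u : K) :
    HahnSeries.ofPowerSeries ℤ K (latticeSeries ϖ n c u) =
      igusa n (Nat.card (ResidueField o) : K⸨X⸩)⁻¹ (fun k => HahnSeries.ofPowerSeries ℤ K
        (C ((Nat.card (ResidueField o) : K) ^ (k * (n - k)) * c ^ k * u) * X ^ k)) := by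
  induction n using Nat.strong_induction_on generalizing c with
  | _ n ih =>
    have hX : ∀ k ∈ Finset.Icc 1 n, 1 - HahnSeries.ofPowerSeries ℤ K
        (C ((Nat.card (ResidueField o) : K) ^ (k * (n - k)) * c ^ k * u) * X ^ k) ≠ 0 :=
      fun k hk => ofPowerSeries_one_sub_ne_zero _ (Finset.mem_Icc.1 hk).1
    have h1 := one_sub_mul_igusa (Nat.card (ResidueField o) : K⸨X⸩)⁻¹ n hX hn
    have h2 := congrArg (HahnSeries.ofPowerSeries ℤ K) (one_sub_mul_latticeSeries hϖ hn c u)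
    refine mul_left_cancel₀ (hX n (Finset.right_mem_Icc.2 hn)) ?_
    rw [h1]
    rw [map_mul, map_sub, map_one, map_add, map_one, map_sum] at h2
    have h3 : (Nat.card (ResidueField o) : K) ^ (n * (n - n)) * c ^ n * u = u * c ^ n := by
      simp [mul_comm]
    rw [h3, h2]
    congr 1
    refine Finset.sum_congr rfl fun i hi => ?_
    have hi := Finset.mem_Ico.1 hi
    rw [map_mul, ih i hi.2 hi.1]
    have h4 : ∀ k ∈ Finset.Icc 1 i, HahnSeries.ofPowerSeries ℤ K
        (C ((Nat.card (ResidueField o) : K) ^ (k * (i - k)) *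
          ((Nat.card (ResidueField o) : K) ^ (n - i) * c) ^ k * u) * X ^ k) =
        HahnSeries.ofPowerSeries ℤ K
          (C ((Nat.card (ResidueField o) : K) ^ (k * (n - k)) * c ^ k * u) * X ^ k) := by
      intro k hk
      have hk := Finset.mem_Icc.1 hk
      have h5 : k * (n - k) = k * (i - k) + (n - i) * k := by
        rw [mul_comm (n - i), ← mul_add]
        congr 1
        omega
      rw [h5, mul_pow, pow_add, ← pow_mul]
      congr 3
      ring
    rw [igusa_congr _ hi.1 h4]
    congr 1
    have h6 := map_subspaceCount ((HahnSeries.ofPowerSeries ℤ K).comp (C : K →+* K⟦X⟧))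
      (Nat.card (ResidueField o)) i (n - i)
    rw [RingHom.comp_apply] at h6
    simp only [map_mul, map_pow, map_natCast]
    rw [h6, subspaceCount, Nat.add_sub_cancel' hi.2.le]
    ring

end Igusa

/-! ### Traceless matrices and their kernels -/

section LevelMaps

open IsLocalRing

variable {o : Type*} [CommRing o] [IsDomain o] [IsDiscreteValuationRing o]

/-- Multiplication by `ϖ ^ (e - N)` as a map from level `N` to level `e`. -/
def levelMap {ϖ : o} (hϖ : Irreducible ϖ) {N e : ℕ} (h : N ≤ e) :
    LevelRing o N →ₗ[o] LevelRing o e :=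
  Submodule.mapQ (maximalIdeal o ^ N) (maximalIdeal o ^ e) (LinearMap.lsmul o o (ϖ ^ (e - N))) (by
    intro a ha
    rw [← Ideal.Quotient.eq_zero_iff_mem, mk_levelRing_eq_zero_iff hϖ] at ha
    rw [Submodule.mem_comap, ← Ideal.Quotient.eq_zero_iff_mem, mk_levelRing_eq_zero_iff hϖ,
      ← Nat.sub_add_cancel h, pow_add, Nat.add_sub_cancel]
    exact mul_dvd_mul_left _ ha)

theorem levelMap_mk {ϖ : o} (hϖ : Irreducible ϖ) {N e : ℕ} (h : N ≤ e) (a : o) :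
    levelMap hϖ h (Ideal.Quotient.mk _ a) = Ideal.Quotient.mk _ (ϖ ^ (e - N) * a) := rfl

theorem levelMap_injective {ϖ : o} (hϖ : Irreducible ϖ) {N e : ℕ} (h : N ≤ e) :
    Function.Injective (levelMap hϖ h) := by
  refine (injective_iff_map_eq_zero _).2 fun x hx => ?_
  obtain ⟨a, rfl⟩ := Ideal.Quotient.mk_surjective x
  rw [levelMap_mk, mk_levelRing_eq_zero_iff hϖ] at hx
  conv at hx => rw [← Nat.sub_add_cancel h, pow_add, Nat.add_sub_cancel]
  rw [mk_levelRing_eq_zero_iff hϖ]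
  exact (mul_dvd_mul_iff_left (pow_ne_zero _ hϖ.ne_zero)).1 hx

theorem smul_mk_levelRing (N : ℕ) (a b : o) :
    a • Ideal.Quotient.mk (maximalIdeal o ^ N) b = Ideal.Quotient.mk _ (a * b) := rfl

theorem pow_smul_levelRing_eq_zero {ϖ : o} (hϖ : Irreducible ϖ) (N : ℕ) (x : LevelRing o N) :
    ϖ ^ N • x = 0 := by
  obtain ⟨a, rfl⟩ := Ideal.Quotient.mk_surjective x
  rw [smul_mk_levelRing, mk_levelRing_eq_zero_iff hϖ]
  exact dvd_mul_right _ _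

theorem pow_smul_eq_zero_iff_exists_levelMap {ϖ : o} (hϖ : Irreducible ϖ) {N e : ℕ} (h : N ≤ e)
    (x : LevelRing o e) : ϖ ^ N • x = 0 ↔ ∃ y, levelMap hϖ h y = x := by
  constructor
  · intro hx
    obtain ⟨a, rfl⟩ := Ideal.Quotient.mk_surjective x
    rw [smul_mk_levelRing, mk_levelRing_eq_zero_iff hϖ, ← Nat.add_sub_cancel' h, pow_add] at hx
    obtain ⟨c, rfl⟩ := (mul_dvd_mul_iff_left (pow_ne_zero _ hϖ.ne_zero)).1 hx
    exact ⟨Ideal.Quotient.mk _ c, levelMap_mk hϖ h c⟩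
  · rintro ⟨y, rfl⟩
    rw [← map_smul, pow_smul_levelRing_eq_zero hϖ, map_zero]

end LevelMaps

/-! ### Kernel lattices, and primitive matrices of all levels inside one level -/

section Kernels

open IsLocalRing

variable {o : Type*} [CommRing o] [IsDomain o] [IsDiscreteValuationRing o] {n : ℕ}

/-- Reduction of vectors to level `N`. -/
def levelReduction (o : Type*) [CommRing o] [IsLocalRing o] (n N : ℕ) :
    (Fin n → o) →ₗ[o] (Fin n → LevelRing o N) :=
  LinearMap.pi fun j => (maximalIdeal o ^ N).mkQ ∘ₗ LinearMap.proj j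

theorem levelReduction_apply (N : ℕ) (v : Fin n → o) (j : Fin n) :
    levelReduction o n N v j = Ideal.Quotient.mk _ (v j) := rfl

theorem levelReduction_surjective (N : ℕ) : Function.Surjective (levelReduction o n N) := by
  intro w
  choose v hv using fun j => Ideal.Quotient.mk_surjective (w j)
  exact ⟨v, funext hv⟩

/-- The vectors over `o` annihilated by a matrix of level `N`. -/
def kernelLattice {N : ℕ} (x : Matrix (Fin n) (Fin n) (LevelRing o N)) :
    Submodule o (Fin n → o) :=
  LinearMap.ker ((Matrix.mulVecLin x).restrictScalars o ∘ₗ levelReduction o n N)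

theorem mem_kernelLattice {N : ℕ} {x : Matrix (Fin n) (Fin n) (LevelRing o N)} {v : Fin n → o} :
    v ∈ kernelLattice x ↔ x.mulVec (levelReduction o n N v) = 0 := Iff.rfl

theorem index_kernelLattice {N : ℕ} (x : Matrix (Fin n) (Fin n) (LevelRing o N)) :
    (kernelLattice x).toAddSubgroup.index = Nat.card (LinearMap.range (Matrix.mulVecLin x)) := by
  set f := (Matrix.mulVecLin x).restrictScalars o ∘ₗ levelReduction o n N with hf
  have h1 : (kernelLattice x).toAddSubgroup = f.toAddMonoidHom.ker := rfl
  rw [h1, AddSubgroup.index_ker]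
  refine Nat.card_congr (Equiv.setCongr ?_)
  ext y
  constructor
  · rintro ⟨v, rfl⟩
    exact ⟨_, rfl⟩
  · rintro ⟨w, rfl⟩
    obtain ⟨v, rfl⟩ := levelReduction_surjective N w
    exact ⟨v, rfl⟩

theorem imageSize_eq_index (p : PrimitiveTraceless o n) :
    imageSize p = (kernelLattice p.2.1).toAddSubgroup.index := (index_kernelLattice _).symm

/-- `levelMap` is `o`-linear and injective, so a vector over `o` is annihilated after rescaling the
matrix exactly when it was before. -/
theorem kernelLattice_map_levelMap {ϖ : o} (hϖ : Irreducible ϖ) {N e : ℕ} (h : N ≤ e)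
    (x : Matrix (Fin n) (Fin n) (LevelRing o N)) :
    kernelLattice (x.map (levelMap hϖ h)) = kernelLattice x := by
  ext v
  rw [mem_kernelLattice, mem_kernelLattice, funext_iff, funext_iff]
  refine forall_congr' fun i => ?_
  have hsmul : ∀ (N : ℕ) (y : LevelRing o N) (a : o),
      y * Ideal.Quotient.mk (maximalIdeal o ^ N) a = a • y := by
    intro N y a
    rw [mul_comm]
    rfl
  have h1 : (x.map (levelMap hϖ h)).mulVec (levelReduction o n e v) i =
      levelMap hϖ h (x.mulVec (levelReduction o n N v) i) := by
    simp only [Matrix.mulVec, dotProduct, levelReduction_apply, Matrix.map_apply, hsmul, map_sum,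
      map_smul]
  rw [h1]
  exact map_eq_zero_iff _ (levelMap_injective hϖ h)

theorem pow_smul_eq_zero_of_forall_mem {ϖ : o} {N e : ℕ}
    {x : Matrix (Fin n) (Fin n) (LevelRing o N)} (h : ∀ v, ϖ ^ e • v ∈ kernelLattice x) :
    ϖ ^ e • x = 0 := by
  ext i j
  have h1 := congrFun (mem_kernelLattice.1 (h (Pi.single j 1))) i
  rw [map_smul, Matrix.mulVec_smul, Pi.smul_apply] at h1
  have h2 : levelReduction o n N (Pi.single j 1) = Pi.single j 1 := by
    ext k
    rw [levelReduction_apply]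
    by_cases hk : k = j
    · subst hk; simp
    · simp [hk]
  rw [h2, Matrix.mulVec_single_one] at h1
  exact h1

theorem trace_map_levelMap {ϖ : o} (hϖ : Irreducible ϖ) {N e : ℕ} (h : N ≤ e)
    (x : Matrix (Fin n) (Fin n) (LevelRing o N)) :
    (x.map (levelMap hϖ h)).trace = levelMap hϖ h x.trace := by
  simp [Matrix.trace, map_sum]

/-- Being killed by `ϖ ^ (N - 1)` means being divisible by `ϖ` entrywise. The point is that the
quotient can be chosen traceless. -/
theorem mem_primitiveTraceless_iff {ϖ : o} (hϖ : Irreducible ϖ) (hn : 1 ≤ n) {N : ℕ} (hN : 1 ≤ N)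
    (x : Matrix (Fin n) (Fin n) (LevelRing o N)) :
    x ∈ primitiveTraceless o n N ↔ x.trace = 0 ∧ ϖ ^ (N - 1) • x ≠ 0 := by
  have htr : x ∈ traceless n (LevelRing o N) ↔ x.trace = 0 := Iff.rfl
  rw [primitiveTraceless, if_neg (by omega), Set.mem_ofPred_eq, htr]
  refine and_congr_right fun h0 => not_congr ⟨fun hx => ?_, fun hx => ?_⟩
  · refine Submodule.smul_induction_on hx (fun r hr s _ => ?_) fun s t hs ht => ?_
    · obtain ⟨a, ha, rfl⟩ :=
        (Ideal.mem_map_iff_of_surjective _ Ideal.Quotient.mk_surjective).1 hr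
      rw [hϖ.maximalIdeal_eq, Ideal.mem_span_singleton] at ha
      obtain ⟨c, rfl⟩ := ha
      ext i j
      have h1 := pow_smul_levelRing_eq_zero hϖ N (s i j)
      change ϖ ^ (N - 1) • (ϖ * c) • s i j = 0
      rw [smul_smul, ← mul_assoc, ← pow_succ, Nat.sub_add_cancel hN, mul_comm, mul_smul, h1,
        smul_zero]
    · rw [smul_add, hs, ht, add_zero]
  · have h1 : ∀ i j, ∃ c : o, ϖ • Ideal.Quotient.mk (maximalIdeal o ^ N) c = x i j := by
      intro i j
      obtain ⟨a, ha⟩ := Ideal.Quotient.mk_surjective (x i j)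
      have h2 : ϖ ^ (N - 1) • x i j = 0 := congrFun (congrFun hx i) j
      have h3 : ϖ ^ N = ϖ ^ (N - 1) * ϖ := by rw [← pow_succ, Nat.sub_add_cancel hN]
      rw [← ha, smul_mk_levelRing, mk_levelRing_eq_zero_iff hϖ, h3] at h2
      obtain ⟨c, rfl⟩ := (mul_dvd_mul_iff_left (pow_ne_zero _ hϖ.ne_zero)).1 h2
      exact ⟨c, ha⟩
    choose c hc using h1
    let z : Matrix (Fin n) (Fin n) (LevelRing o N) := fun i j => Ideal.Quotient.mk _ (c i j)
    have hz : ϖ • z = x := by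
      ext i j
      exact hc i j
    have h2 : ϖ • z.trace = 0 := by rw [← Matrix.trace_smul, hz, h0]
    let i₀ : Fin n := ⟨0, hn⟩
    -- The quotient `z` need not be traceless, but `ϖ` kills its trace, so removing the trace from
    -- one diagonal entry does not change `ϖ • z`.
    let w := z - Matrix.single i₀ i₀ z.trace
    have hw : w.trace = 0 := by simp [w]
    have hw' : ϖ • w = x := by
      rw [smul_sub, hz, Matrix.smul_single, h2, Matrix.single_zero, sub_zero]
    rw [← hw']
    refine Submodule.smul_mem_smul (r := Ideal.Quotient.mk _ ϖ)
      (Ideal.mem_map_of_mem _ ?_) (show w ∈ traceless n _ from hw)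
    rw [hϖ.maximalIdeal_eq]
    exact Ideal.mem_span_singleton_self ϖ

theorem trace_eq_zero_of_mem_primitiveTraceless {N : ℕ}
    {x : Matrix (Fin n) (Fin n) (LevelRing o N)} (hx : x ∈ primitiveTraceless o n N) :
    x.trace = 0 := by
  rw [primitiveTraceless] at hx
  split_ifs at hx with h
  · rw [Set.mem_singleton_iff.1 hx, Matrix.trace_zero]
  · exact hx.1

theorem le_of_pow_smul_eq_zero {ϖ : o} (hϖ : Irreducible ϖ) (hn : 1 ≤ n)
    (p : PrimitiveTraceless o n) {e : ℕ} (h : ϖ ^ e • p.2.1 = 0) : p.1 ≤ e := by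
  by_contra hlt
  push Not at hlt
  refine ((mem_primitiveTraceless_iff hϖ hn (by omega) _).1 p.2.2).2 ?_
  rw [← Nat.sub_add_cancel (show e ≤ p.1 - 1 by omega), pow_add, mul_smul, h, smul_zero]

/-- For `y` of level `e`, let `N` be least with `ϖ ^ N • y = 0`. Then `y` is `ϖ ^ (e - N)` times a
unique matrix of level `N`, and minimality of `N` is its primitivity. -/
theorem exists_equiv_traceless {ϖ : o} (hϖ : Irreducible ϖ) (hn : 1 ≤ n) (e : ℕ) :
    ∃ f : {p : PrimitiveTraceless o n // p.1 ≤ e} ≃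
      {y : Matrix (Fin n) (Fin n) (LevelRing o e) // y.trace = 0},
      ∀ p, kernelLattice (f p).1 = kernelLattice p.1.2.1 := by
  let F : {p : PrimitiveTraceless o n // p.1 ≤ e} →
      {y : Matrix (Fin n) (Fin n) (LevelRing o e) // y.trace = 0} := fun p =>
    ⟨p.1.2.1.map (levelMap hϖ p.2), by
      rw [trace_map_levelMap, trace_eq_zero_of_mem_primitiveTraceless p.1.2.2, map_zero]⟩
  have hsmul : ∀ p k, ϖ ^ k • (F p).1 = 0 ↔ ϖ ^ k • p.1.2.1 = 0 := by
    intro p k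
    rw [← Matrix.ext_iff, ← Matrix.ext_iff]
    refine forall_congr' fun i => forall_congr' fun j => ?_
    change ϖ ^ k • levelMap hϖ p.2 (p.1.2.1 i j) = 0 ↔ ϖ ^ k • p.1.2.1 i j = 0
    rw [← map_smul]
    exact map_eq_zero_iff _ (levelMap_injective hϖ p.2)
  have hzero : ∀ p : PrimitiveTraceless o n, ϖ ^ p.1 • p.2.1 = 0 := by
    intro p
    ext i j
    exact pow_smul_levelRing_eq_zero hϖ p.1 _
  have hle : ∀ p p', F p = F p' → p.1.1 ≤ p'.1.1 := by
    intro p p' h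
    refine le_of_pow_smul_eq_zero hϖ hn p.1 ((hsmul p _).1 ?_)
    rw [h, hsmul p', hzero]
  have hinj : Function.Injective F := by
    intro p p' h
    have hN := le_antisymm (hle p p' h) (hle p' p h.symm)
    obtain ⟨⟨N, x, hx⟩, hp⟩ := p
    obtain ⟨⟨N', x', hx'⟩, hp'⟩ := p'
    obtain rfl : N = N' := hN
    have h1 : x = x' :=
      Matrix.map_injective (levelMap_injective hϖ hp) (congrArg Subtype.val h)
    subst h1
    rfl
  have hsurj : Function.Surjective F := by
    classical
    rintro ⟨y, hy⟩
    have hex : ∃ N, ϖ ^ N • y = 0 := by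
      refine ⟨e, ?_⟩
      ext i j
      exact pow_smul_levelRing_eq_zero hϖ e _
    set N := Nat.find hex with hN
    have hNe : N ≤ e := Nat.find_min' hex (by
      ext i j
      exact pow_smul_levelRing_eq_zero hϖ e _)
    have hNy : ϖ ^ N • y = 0 := Nat.find_spec hex
    choose x hx using fun i j => (pow_smul_eq_zero_iff_exists_levelMap hϖ hNe (y i j)).1
      (congrFun (congrFun hNy i) j)
    have hxy : (Matrix.of x).map (levelMap hϖ hNe) = y := by
      ext i j
      exact hx i j
    have hprim : Matrix.of x ∈ primitiveTraceless o n N := by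
      rcases Nat.eq_zero_or_pos N with h0 | h0
      · rw [primitiveTraceless, if_pos h0, Set.mem_singleton_iff]
        ext i j
        have := pow_smul_levelRing_eq_zero hϖ N (Matrix.of x i j)
        have h1 : ϖ ^ N = 1 := by rw [h0, pow_zero]
        rwa [h1, one_smul] at this
      · rw [mem_primitiveTraceless_iff hϖ hn h0]
        constructor
        · refine (map_eq_zero_iff _ (levelMap_injective hϖ hNe)).1 ?_
          rw [← trace_map_levelMap, hxy, hy]
        · intro h
          refine Nat.find_min hex (show N - 1 < N by omega) ?_
          rw [← hxy]
          ext i j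
          have h1 : ϖ ^ (N - 1) • x i j = 0 := congrFun (congrFun h i) j
          change ϖ ^ (N - 1) • levelMap hϖ hNe (x i j) = 0
          rw [← map_smul, h1, map_zero]
    exact ⟨⟨⟨N, Matrix.of x, hprim⟩, hNe⟩, Subtype.ext hxy⟩
  exact ⟨Equiv.ofBijective F ⟨hinj, hsurj⟩, fun p => kernelLattice_map_levelMap hϖ p.2 _⟩

end Kernels

/-! ### Counting matrices and lattices -/

section Counting

open IsLocalRing Module

variable {o : Type*} [CommRing o] [IsDomain o] [IsDiscreteValuationRing o] {n : ℕ}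

theorem card_pow_torsion {ϖ : o} (hϖ : Irreducible ϖ) {l e : ℕ} (h : l ≤ e) :
    Nat.card {a : LevelRing o e // ϖ ^ l • a = 0} = Nat.card (ResidueField o) ^ l := by
  rw [← card_levelRing]
  refine (Nat.card_congr (Equiv.ofBijective
    (fun y => ⟨levelMap hϖ h y, (pow_smul_eq_zero_iff_exists_levelMap hϖ h _).2 ⟨y, rfl⟩⟩)
    ⟨fun y y' hy => levelMap_injective hϖ h (congrArg Subtype.val hy), fun a => ?_⟩)).symm
  obtain ⟨y, hy⟩ := (pow_smul_eq_zero_iff_exists_levelMap hϖ h _).1 a.2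
  exact ⟨y, Subtype.ext hy⟩

theorem le_kernelLattice_iff {ϖ : o} {e : ℕ} (b : Basis (Fin n) o (Fin n → o))
    (l : Fin n → ℕ) {L : Submodule o (Fin n → o)} (hL : ∀ v, v ∈ L ↔ ∀ j, ϖ ^ l j ∣ b.repr v j)
    (y : Matrix (Fin n) (Fin n) (LevelRing o e)) :
    L ≤ kernelLattice y ↔ ∀ j, ϖ ^ l j • y.mulVec (levelReduction o n e (b j)) = 0 := by
  have h1 : ∀ j, ϖ ^ l j • b j ∈ kernelLattice y ↔
      ϖ ^ l j • y.mulVec (levelReduction o n e (b j)) = 0 := by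
    intro j
    rw [mem_kernelLattice, map_smul, Matrix.mulVec_smul]
  simp only [← h1]
  constructor
  · intro h j
    refine h ((hL _).2 fun i => ?_)
    rw [map_smul, Finsupp.smul_apply, Basis.repr_self, smul_eq_mul]
    by_cases hij : j = i
    · subst hij
      exact dvd_mul_right _ _
    · rw [Finsupp.single_eq_of_ne (Ne.symm hij), mul_zero]
      exact dvd_zero _
  · intro h v hv
    choose c hc using (hL v).1 hv
    rw [← b.sum_repr v]
    refine Submodule.sum_mem _ fun j _ => ?_
    rw [hc, mul_comm, mul_smul]
    exact Submodule.smul_mem _ _ (h j)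

/-- The number of traceless matrices whose columns are annihilated by given powers of `ϖ`. -/
theorem card_traceless_torsion {ϖ : o} (hϖ : Irreducible ϖ) {e : ℕ} (l : Fin n → ℕ)
    (hl : ∀ j, l j ≤ e) (j₀ : Fin n) (hj₀ : ∀ j, l j ≤ l j₀) :
    Nat.card {z : Matrix (Fin n) (Fin n) (LevelRing o e) //
        z.trace = 0 ∧ ∀ i j, ϖ ^ l j • z i j = 0} * Nat.card (ResidueField o) ^ l j₀ =
      Nat.card (ResidueField o) ^ (n * ∑ j, l j) := by
  classical
  have h1 : Nat.card {z : Matrix (Fin n) (Fin n) (LevelRing o e) // ∀ i j, ϖ ^ l j • z i j = 0} =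
      Nat.card (ResidueField o) ^ (n * ∑ j, l j) := by
    rw [Nat.card_congr (β := ∀ (_ : Fin n) (j : Fin n), {a : LevelRing o e // ϖ ^ l j • a = 0})
      { toFun := fun z i j => ⟨z.1 i j, z.2 i j⟩
        invFun := fun z => ⟨fun i j => (z i j).1, fun i j => (z i j).2⟩
        left_inv := fun z => rfl
        right_inv := fun z => rfl }]
    rw [Nat.card_pi, Finset.prod_const, Finset.card_univ, Fintype.card_fin, Nat.card_pi,
      Finset.prod_congr rfl fun j _ => card_pow_torsion hϖ (hl j), Finset.prod_pow_eq_pow_sum,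
      ← pow_mul, mul_comm]
  have htr : ∀ z : Matrix (Fin n) (Fin n) (LevelRing o e), (∀ i j, ϖ ^ l j • z i j = 0) →
      ϖ ^ l j₀ • z.trace = 0 := by
    intro z hz
    rw [Matrix.trace, Finset.smul_sum]
    refine Finset.sum_eq_zero fun j _ => ?_
    rw [Matrix.diag_apply, ← Nat.sub_add_cancel (hj₀ j), pow_add, mul_smul, hz, smul_zero]
  have hsingle : ∀ a : LevelRing o e, ϖ ^ l j₀ • a = 0 →
      ∀ i j, ϖ ^ l j • Matrix.single j₀ j₀ a i j = 0 := by
    intro a ha i j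
    by_cases hj : j = j₀
    · subst hj
      by_cases hi : i = j
      · subst hi
        rwa [Matrix.single_apply_same]
      · rw [Matrix.single_apply_of_row_ne (Ne.symm hi), smul_zero]
    · rw [Matrix.single_apply_of_col_ne _ _ (Ne.symm hj), smul_zero]
  -- Every matrix with the column conditions is uniquely a traceless one plus its trace placed at
  -- `(j₀, j₀)`. Maximality of `l j₀` puts the trace in the `ϖ ^ l j₀`-torsion, which is the torsion
  -- allowed in column `j₀`.
  rw [← h1, ← card_pow_torsion hϖ (hl j₀), ← Nat.card_prod]
  refine Nat.card_congr
    { toFun := fun p => ⟨p.1.1 + Matrix.single j₀ j₀ p.2.1, fun i j => ?_⟩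
      invFun := fun z => ⟨⟨z.1 - Matrix.single j₀ j₀ z.1.trace, ?_, fun i j => ?_⟩,
        ⟨z.1.trace, htr z.1 z.2⟩⟩
      left_inv := fun p => ?_
      right_inv := fun z => ?_ }
  · rw [Matrix.add_apply, smul_add, p.1.2.2, hsingle _ p.2.2, add_zero]
  · simp
  · rw [Matrix.sub_apply, smul_sub, z.2, hsingle _ (htr z.1 z.2), sub_zero]
  · obtain ⟨⟨z, hz, hz'⟩, ⟨a, ha⟩⟩ := p
    ext1 <;> ext1 <;> simp [hz]
  · ext1
    simp

variable [Finite (ResidueField o)]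

theorem exists_injective_range_eq {a : ℕ} (L : LatticeOfIndex o n a) :
    ∃ f : (Fin n → o) →ₗ[o] (Fin n → o), Function.Injective f ∧ LinearMap.range f = L.1 := by
  obtain ⟨ϖ, hϖ⟩ := IsDiscreteValuationRing.exists_irreducible o
  have hq := one_lt_card_residueField o
  obtain ⟨b, l, h⟩ := exists_diagonal_basis hϖ (Pi.basisFun o (Fin n)) L.1 (by
    rw [L.2]; positivity)
  let d : (Fin n → o) →ₗ[o] (Fin n → o) :=
    LinearMap.pi fun j => ϖ ^ l j • LinearMap.proj j
  refine ⟨b.equivFun.symm.toLinearMap ∘ₗ d, ?_, ?_⟩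
  · refine b.equivFun.symm.injective.comp fun v w hvw => ?_
    ext j
    exact mul_left_cancel₀ (pow_ne_zero _ hϖ.ne_zero) (congrFun hvw j)
  · ext v
    rw [h]
    constructor
    · rintro ⟨w, rfl⟩ j
      change ϖ ^ l j ∣ b.equivFun (b.equivFun.symm (d w)) j
      rw [LinearEquiv.apply_symm_apply]
      exact ⟨w j, rfl⟩
    · intro hv
      choose w hw using hv
      refine ⟨w, ?_⟩
      rw [LinearMap.comp_apply, LinearEquiv.coe_coe, LinearEquiv.symm_apply_eq]
      exact funext fun j => (hw j).symm

/-- `L` is the image of an injective endomorphism of `o ^ n`, and transport along it multiplies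
indices by `q ^ a`. -/
theorem card_sublattices {a : ℕ} (L : LatticeOfIndex o n a) (m : ℕ) :
    Nat.card {L' : LatticeOfIndex o n m // L'.1 ≤ L.1} =
      if a ≤ m then Nat.card (LatticeOfIndex o n (m - a)) else 0 := by
  have hq := one_lt_card_residueField o
  split_ifs with h
  · obtain ⟨m, rfl⟩ := Nat.exists_eq_add_of_le' h
    rw [Nat.add_sub_cancel]
    obtain ⟨f, hf, hfL⟩ := exists_injective_range_eq L
    have hidx : ∀ N : Submodule o (Fin n → o), (N.map f).toAddSubgroup.index =
        Nat.card (ResidueField o) ^ (m + a) ↔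
        N.toAddSubgroup.index = Nat.card (ResidueField o) ^ m := by
      intro N
      rw [index_map_toAddSubgroup hf, hfL, L.2, pow_add]
      exact Nat.mul_left_inj (by positivity)
    refine Nat.card_congr
      { toFun := fun N => ⟨N.1.1.comap f, (hidx _).1 ?_⟩
        invFun := fun N => ⟨⟨N.1.map f, (hidx _).2 N.2⟩, ?_⟩
        left_inv := fun N => ?_
        right_inv := fun N => ?_ }
    · rw [Submodule.map_comap_eq, hfL, inf_eq_right.2 N.2]
      exact N.1.2
    · exact LinearMap.map_le_range.trans_eq hfL
    · ext1
      ext1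
      change (N.1.1.comap f).map f = N.1.1
      rw [Submodule.map_comap_eq, hfL, inf_eq_right.2 N.2]
    · ext1
      exact Submodule.comap_map_eq_of_injective hf _
  · have : IsEmpty {L' : LatticeOfIndex o n m // L'.1 ≤ L.1} := by
      refine ⟨fun N => h ?_⟩
      have h1 := AddSubgroup.index_dvd_of_le (H := N.1.1.toAddSubgroup)
        (K := L.1.toAddSubgroup) fun _ hx => N.2 hx
      rw [L.2, N.1.2] at h1
      exact (Nat.pow_dvd_pow_iff_le_right hq).1 h1
    exact Nat.card_of_isEmpty

/-- Conjugating by the base change to a basis adapted to `L` preserves the trace and turns the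
containment into the column conditions of `card_traceless_torsion`. The largest `l j` is the
exponent; `m ≤ e` ensures that level `e` contains all the torsion needed. -/
theorem card_traceless_le_kernelLattice {ϖ : o} (hϖ : Irreducible ϖ) (hn : 1 ≤ n) {m e : ℕ}
    (hm : m ≤ e) (L : LatticeOfIndex o n m) :
    Nat.card {y : Matrix (Fin n) (Fin n) (LevelRing o e) // y.trace = 0 ∧ L.1 ≤ kernelLattice y} *
      Nat.card (ResidueField o) ^ exponent ϖ L.1 = Nat.card (ResidueField o) ^ (n * m) := by
  have hq := one_lt_card_residueField o
  obtain ⟨b, l, h⟩ := exists_diagonal_basis hϖ (Pi.basisFun o (Fin n)) L.1 (by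
    rw [L.2]; positivity)
  have hsum : ∑ j, l j = m :=
    Nat.pow_right_injective hq ((index_eq_of_diagonal_basis hϖ b l h).symm.trans L.2)
  have hl : ∀ j, l j ≤ e := fun j =>
    ((Finset.single_le_sum (f := l) (fun _ _ => Nat.zero_le _) (Finset.mem_univ j)).trans_eq
      hsum).trans hm
  have : Nonempty (Fin n) := ⟨⟨0, hn⟩⟩
  obtain ⟨j₀, -, hj₀⟩ := Finset.exists_max_image Finset.univ l Finset.univ_nonempty
  have hexp : exponent ϖ L.1 = l j₀ := by
    rw [exponent_eq_of_diagonal_basis hϖ b l h]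
    exact le_antisymm (Finset.sup_le hj₀) (Finset.le_sup (Finset.mem_univ j₀))
  rw [hexp]
  refine Eq.trans ?_ (congrArg (fun k => Nat.card (ResidueField o) ^ (n * k)) hsum)
  rw [← card_traceless_torsion hϖ l hl j₀ fun j => hj₀ j (Finset.mem_univ j)]
  congr 1
  let red : o →+* LevelRing o e := Ideal.Quotient.mk _
  let P : Matrix (Fin n) (Fin n) (LevelRing o e) :=
    ((Pi.basisFun o (Fin n)).toMatrix b).map red
  let Q : Matrix (Fin n) (Fin n) (LevelRing o e) :=
    (b.toMatrix (Pi.basisFun o (Fin n))).map red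
  have hPQ : P * Q = 1 := by
    rw [← Matrix.map_mul, Basis.toMatrix_mul_toMatrix_flip]
    simp
  have hQP : Q * P = 1 := mul_eq_one_comm.1 hPQ
  have hcol : ∀ (y : Matrix (Fin n) (Fin n) (LevelRing o e)) (i j : Fin n),
      y.mulVec (levelReduction o n e (b j)) i = (y * P) i j := by
    intro y i j
    rfl
  have hQsmul : ∀ (y : Matrix (Fin n) (Fin n) (LevelRing o e)),
      (∀ i j, ϖ ^ l j • y i j = 0) → ∀ (R : Matrix (Fin n) (Fin n) (LevelRing o e)) (i j : Fin n),
        ϖ ^ l j • (R * y) i j = 0 := by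
    intro y hy R i j
    rw [Matrix.mul_apply, Finset.smul_sum]
    refine Finset.sum_eq_zero fun k _ => ?_
    rw [← mul_smul_comm, hy, mul_zero]
  have hle : ∀ y : Matrix (Fin n) (Fin n) (LevelRing o e),
      L.1 ≤ kernelLattice y ↔ ∀ i j, ϖ ^ l j • (y * P) i j = 0 := by
    intro y
    rw [le_kernelLattice_iff b l h, forall_comm]
    refine forall_congr' fun j => ?_
    rw [funext_iff]
    exact forall_congr' fun i => by rw [Pi.smul_apply, hcol]; rfl
  refine Nat.card_congr
    { toFun := fun y => ⟨Q * y.1 * P, ?_, ?_⟩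
      invFun := fun z => ⟨P * z.1 * Q, ?_, ?_⟩
      left_inv := fun y => ?_
      right_inv := fun z => ?_ }
  · rw [Matrix.trace_mul_comm, ← mul_assoc, hPQ, one_mul, y.2.1]
  · rw [mul_assoc]
    exact hQsmul _ ((hle y.1).1 y.2.2) Q
  · rw [Matrix.trace_mul_comm, ← mul_assoc, hQP, one_mul, z.2.1]
  · rw [hle, mul_assoc, hQP, mul_one]
    exact hQsmul _ z.2.2 P
  · ext1
    change P * (Q * y.1 * P) * Q = y.1
    rw [mul_assoc Q, ← mul_assoc P, hPQ, one_mul, mul_assoc, hPQ, mul_one]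
  · ext1
    change Q * (P * z.1 * Q) * P = z.1
    rw [mul_assoc P, ← mul_assoc Q, hQP, one_mul, mul_assoc, hQP, mul_one]

end Counting

/-! ### The image zeta function and the lattice series -/

section ImageZetaSeries

open IsLocalRing

variable {o : Type*} [CommRing o] [IsDomain o] [IsDiscreteValuationRing o]
  [Finite (ResidueField o)] {n : ℕ}

theorem index_kernelLattice_ne_zero {N : ℕ} (x : Matrix (Fin n) (Fin n) (LevelRing o N)) :
    (kernelLattice x).toAddSubgroup.index ≠ 0 := by
  rw [index_kernelLattice]
  exact Nat.card_pos.ne'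

theorem exists_index_kernelLattice_eq {N : ℕ} (x : Matrix (Fin n) (Fin n) (LevelRing o N)) :
    ∃ a, (kernelLattice x).toAddSubgroup.index = Nat.card (ResidueField o) ^ a :=
  have ⟨_, hϖ⟩ := IsDiscreteValuationRing.exists_irreducible o
  exists_index_eq_pow hϖ (Pi.basisFun o (Fin n)) _ (index_kernelLattice_ne_zero x)

theorem exists_imageSize_eq (p : PrimitiveTraceless o n) :
    ∃ a, imageSize p = Nat.card (ResidueField o) ^ a := by
  rw [imageSize_eq_index]
  exact exists_index_kernelLattice_eq _

theorem level_le_of_imageSize_eq (hn : 1 ≤ n) {a : ℕ} (p : PrimitiveTraceless o n)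
    (hp : imageSize p = Nat.card (ResidueField o) ^ a) : p.1 ≤ a := by
  obtain ⟨ϖ, hϖ⟩ := IsDiscreteValuationRing.exists_irreducible o
  rw [imageSize_eq_index] at hp
  exact le_of_pow_smul_eq_zero hϖ hn p
    (pow_smul_eq_zero_of_forall_mem (pow_smul_mem_of_index_eq hϖ (Pi.basisFun o (Fin n)) hp))

/-- A primitive matrix with image of size `q ^ a` has level at most `a`, because `ϖ ^ a` maps `o ^
n` into its kernel lattice. Hence level `e ≥ a` sees all of them. -/
theorem nonempty_equiv_imageSize (hn : 1 ≤ n) {a e : ℕ} (h : a ≤ e) :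
    Nonempty ({p : PrimitiveTraceless o n // imageSize p = Nat.card (ResidueField o) ^ a} ≃
      {y : {y : Matrix (Fin n) (Fin n) (LevelRing o e) // y.trace = 0} //
        (kernelLattice y.1).toAddSubgroup.index = Nat.card (ResidueField o) ^ a}) := by
  obtain ⟨ϖ, hϖ⟩ := IsDiscreteValuationRing.exists_irreducible o
  obtain ⟨f, hf⟩ := exists_equiv_traceless hϖ hn e
  let g : {p : PrimitiveTraceless o n // imageSize p = Nat.card (ResidueField o) ^ a} ≃
      {p : {p : PrimitiveTraceless o n // p.1 ≤ e} //
        imageSize p.1 = Nat.card (ResidueField o) ^ a} :=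
    { toFun := fun p => ⟨⟨p.1, (level_le_of_imageSize_eq hn p.1 p.2).trans h⟩, p.2⟩
      invFun := fun p => ⟨p.1.1, p.2⟩
      left_inv := fun p => rfl
      right_inv := fun p => rfl }
  refine ⟨g.trans (f.subtypeEquiv fun p => ?_)⟩
  rw [hf, imageSize_eq_index]

theorem finite_imageSize_eq (hn : 1 ≤ n) (a : ℕ) :
    Finite {p : PrimitiveTraceless o n // imageSize p = Nat.card (ResidueField o) ^ a} :=
  have ⟨f⟩ := nonempty_equiv_imageSize (o := o) hn (le_refl a)
  have : Finite (Matrix (Fin n) (Fin n) (LevelRing o a)) :=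
    inferInstanceAs (Finite (Fin n → Fin n → LevelRing o a))
  Finite.of_equiv _ f.symm

/-- Both sides count pairs `(y, L)` at level `m` with `L` of index `q ^ m` inside the kernel lattice
of `y`: on the left by `y`, whose kernel has index `q ^ p.1`, on the right by `L`. -/
theorem sum_card_imageSize_mul (hn : 1 ≤ n) (m : ℕ) :
    ∑ p ∈ Finset.HasAntidiagonal.antidiagonal m,
      Nat.card {x : PrimitiveTraceless o n // imageSize x = Nat.card (ResidueField o) ^ p.1} *
        Nat.card (LatticeOfIndex o n p.2) =
    ∑ L : LatticeOfIndex o n m, Nat.card {y : Matrix (Fin n) (Fin n) (LevelRing o m) //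
      y.trace = 0 ∧ L.1 ≤ kernelLattice y} := by
  classical
  have hq := one_lt_card_residueField o
  have : Finite (Matrix (Fin n) (Fin n) (LevelRing o m)) :=
    inferInstanceAs (Finite (Fin n → Fin n → LevelRing o m))
  let T := {y : Matrix (Fin n) (Fin n) (LevelRing o m) // y.trace = 0}
  have := Fintype.ofFinite T
  choose a ha using fun y : T => exists_index_kernelLattice_eq y.1
  have h1 : ∀ p ∈ Finset.HasAntidiagonal.antidiagonal m,
      Nat.card {x : PrimitiveTraceless o n // imageSize x = Nat.card (ResidueField o) ^ p.1} *
        Nat.card (LatticeOfIndex o n p.2) =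
      ∑ y : T, if a y = p.1 then Nat.card (LatticeOfIndex o n p.2) else 0 := by
    intro p hp
    obtain ⟨f⟩ := nonempty_equiv_imageSize (o := o) hn
      (e := m) (a := p.1) (by
      have := Finset.HasAntidiagonal.mem_antidiagonal.1 hp
      omega)
    rw [Nat.card_congr f, Nat.subtype_card (Finset.univ.filter fun y : T => a y = p.1),
      ← Finset.sum_filter, Finset.sum_const, smul_eq_mul]
    intro y
    rw [Finset.mem_filter, ha]
    simp only [Finset.mem_univ, true_and]
    exact (Nat.pow_right_injective hq).eq_iff.symm
  have h2 : ∀ y : T, ∑ p ∈ Finset.HasAntidiagonal.antidiagonal m,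
      (if a y = p.1 then Nat.card (LatticeOfIndex o n p.2) else 0) =
      Nat.card {L : LatticeOfIndex o n m // L.1 ≤ kernelLattice y.1} := by
    intro y
    rw [card_sublattices ⟨kernelLattice y.1, ha y⟩ m,
      Finset.Nat.sum_antidiagonal_eq_sum_range_succ_mk]
    simp
  have h3 : ∀ L : LatticeOfIndex o n m, Nat.card {y : Matrix (Fin n) (Fin n) (LevelRing o m) //
      y.trace = 0 ∧ L.1 ≤ kernelLattice y} = Nat.card {y : T // L.1 ≤ kernelLattice y.1} :=
    fun L => (Nat.card_congr (Equiv.subtypeSubtypeEquivSubtypeInter _ _)).symm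
  rw [Finset.sum_congr rfl h1, Finset.sum_comm, Finset.sum_congr rfl fun y _ => h2 y,
    Finset.sum_congr rfl fun L _ => h3 L, ← Nat.card_sigma, ← Nat.card_sigma]
  exact Nat.card_congr
    { toFun := fun x => ⟨x.2.1, x.1, x.2.2⟩
      invFun := fun x => ⟨x.2.1, x.1, x.2.2⟩
      left_inv := fun x => rfl
      right_inv := fun x => rfl }

theorem imageZeta_mul_latticeSeries {ϖ : o} (hϖ : Irreducible ϖ) (hn : 1 ≤ n) :
    imageZeta o n * latticeSeries ϖ n 1 1 =
      latticeSeries ϖ n ((Nat.card (ResidueField o) : ℚ) ^ n) (Nat.card (ResidueField o) : ℚ)⁻¹ := by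
  have hq : (Nat.card (ResidueField o) : ℚ) ≠ 0 := by
    exact_mod_cast (zero_lt_one.trans (one_lt_card_residueField o)).ne'
  ext m
  have h1 := congrArg (Nat.cast : ℕ → ℚ) (sum_card_imageSize_mul (o := o) hn m)
  push_cast at h1
  have h2 : ∀ k, latticeSum ϖ n k (1 : ℚ) = Nat.card (LatticeOfIndex o n k) := by
    intro k
    simp [latticeSum]
  simp only [PowerSeries.coeff_mul, imageZeta, latticeSeries, PowerSeries.coeff_mk, one_pow,
    one_mul, h2]
  rw [h1, latticeSum, Finset.mul_sum]
  refine Finset.sum_congr rfl fun L _ => ?_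
  have h3 := congrArg (Nat.cast : ℕ → ℚ) (card_traceless_le_kernelLattice hϖ hn le_rfl L)
  push_cast at h3
  rw [← pow_mul, ← h3, inv_pow, mul_assoc, mul_inv_cancel₀ (pow_ne_zero _ hq), mul_one]

theorem imageZeta_eq {ϖ : o} (hϖ : Irreducible ϖ) (hn : 1 ≤ n) :
    imageZeta o n =
      latticeSeries ϖ n ((Nat.card (ResidueField o) : ℚ) ^ n) (Nat.card (ResidueField o) : ℚ)⁻¹ *
        ∏ j ∈ Finset.range n, (1 - (Nat.card (ResidueField o) : ℚ⟦X⟧) ^ j * PowerSeries.X) := by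
  have h := latticeSeries_mul_prod hϖ n (1 : ℚ)
  simp only [map_one, one_mul] at h
  rw [← imageZeta_mul_latticeSeries hϖ hn, mul_assoc, h, mul_one]

end ImageZetaSeries

/-! ### The identities of formal Laurent series -/

section Laurent

open IsLocalRing

variable {o : Type*} [CommRing o] [IsDomain o] [IsDiscreteValuationRing o]
  [Finite (ResidueField o)] {n : ℕ}

/-- The left side is the exponent of `q` in `q ^ (k (n - k)) c ^ k` at `c = q ^ n`; the final `+ 1`
is cancelled by `u = q⁻¹`. The range of `k` makes the truncated subtractions exact. -/
theorem igusa_exponent_eq {k : ℕ} (hk : 1 ≤ k) (hkn : k ≤ n) :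
    k * (n - k) + n * k = n ^ 2 - (n - k) ^ 2 - 1 + 1 := by
  obtain ⟨d, rfl⟩ := Nat.exists_eq_add_of_le hkn
  obtain ⟨k, rfl⟩ := Nat.exists_eq_add_of_le' hk
  have : (k + 1 + d) ^ 2 = d ^ 2 + ((k + 1) * d + (k + 1 + d) * (k + 1)) := by ring
  rw [Nat.add_sub_cancel_left, this, Nat.add_sub_cancel_left]
  have : 1 ≤ (k + 1) * d + (k + 1 + d) * (k + 1) := by nlinarith
  omega

theorem ofPowerSeries_imageZeta (hn : 1 ≤ n) {q : ℕ} (hq : q = Nat.card (ResidueField o))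
    {t : ℚ⸨X⸩} (ht : t = HahnSeries.ofPowerSeries ℤ ℚ PowerSeries.X) :
    HahnSeries.ofPowerSeries ℤ ℚ (imageZeta o n) =
      igusa n (q : ℚ⸨X⸩)⁻¹
        (fun k => (q : ℚ⸨X⸩) ^ (n ^ 2 - (n - k) ^ 2 - 1) * t ^ (n - (n - k))) *
      ∏ j ∈ Finset.range n, (1 - (q : ℚ⸨X⸩) ^ j * t) := by
  obtain ⟨ϖ, hϖ⟩ := IsDiscreteValuationRing.exists_irreducible o
  have hq1 := one_lt_card_residueField o
  rw [← hq] at hq1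
  have hq0 : (q : ℚ) ≠ 0 := by exact_mod_cast (by omega : q ≠ 0)
  rw [imageZeta_eq hϖ hn, map_mul, ofPowerSeries_latticeSeries hϖ hn, ← hq]
  congr 1
  · refine igusa_congr _ hn fun k hk => ?_
    have hk := Finset.mem_Icc.1 hk
    have h1 : (q : ℚ) ^ (k * (n - k)) * ((q : ℚ) ^ n) ^ k * (q : ℚ)⁻¹ =
        (q : ℚ) ^ (n ^ 2 - (n - k) ^ 2 - 1) := by
      rw [← pow_mul, ← pow_add, igusa_exponent_eq hk.1 hk.2, pow_succ, mul_assoc,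
        mul_inv_cancel₀ hq0, mul_one]
    rw [h1, ht, Nat.sub_sub_self hk.2]
    simp only [map_mul, map_pow, map_natCast]
  · simp only [map_prod, map_sub, map_one, map_mul, map_pow, map_natCast, ht]

theorem prod_range_sub_eq_prod_Icc {M : Type*} [CommMonoid M] (f : ℕ → M) (n : ℕ) :
    ∏ j ∈ Finset.range n, f (n - j) = ∏ i ∈ Finset.Icc 1 n, f i := by
  refine Finset.prod_nbij' (fun j => n - j) (fun i => n - i) ?_ ?_ ?_ ?_ fun j _ => rfl
  all_goals
    intro i hi
    simp only [Finset.mem_range, Finset.mem_Icc] at hi ⊢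
    omega

theorem ofPowerSeries_imageZeta_eq_sum_perm (hn : 1 ≤ n) {q : ℕ}
    (hq : q = Nat.card (ResidueField o)) {t : ℚ⸨X⸩}
    (ht : t = HahnSeries.ofPowerSeries ℤ ℚ PowerSeries.X) :
    HahnSeries.ofPowerSeries ℤ ℚ (imageZeta o n) *
        ∏ j ∈ Finset.range n, (1 - (q : ℚ⸨X⸩) ^ (n ^ 2 - j ^ 2 - 1) * t ^ (n - j)) =
      (∑ w : Equiv.Perm (Fin n), ((q : ℚ⸨X⸩)⁻¹) ^ SymmetricGroup.length w *
        ∏ j ∈ SymmetricGroup.descents w, (q : ℚ⸨X⸩) ^ (n ^ 2 - j ^ 2 - 1) * t ^ (n - j)) *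
      ∏ j ∈ Finset.range n, (1 - (q : ℚ⸨X⸩) ^ j * t) := by
  have hq1 := one_lt_card_residueField o
  rw [← hq] at hq1
  set Z : ℕ → ℚ⸨X⸩ := fun k => (q : ℚ⸨X⸩) ^ (n ^ 2 - (n - k) ^ 2 - 1) * t ^ (n - (n - k)) with hZ
  have hY : ∀ j, 1 ≤ j → ((q : ℚ⸨X⸩)⁻¹) ^ j ≠ 1 := by
    intro j hj h
    -- Constants embed injectively into Laurent series, so the question descends to `ℚ`.
    have h1 : (HahnSeries.ofPowerSeries ℤ ℚ).comp (PowerSeries.C (R := ℚ)) (((q : ℚ)⁻¹) ^ j) = 1 := by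
      rw [map_pow, map_inv₀, map_natCast, h]
    rw [map_eq_one_iff _ (RingHom.injective _)] at h1
    exact natCast_inv_pow_ne_one hq1 j hj h1
  have hX : ∀ k ∈ Finset.Icc 1 n, 1 - Z k ≠ 0 := by
    intro k hk
    have hk := Finset.mem_Icc.1 hk
    have h := ofPowerSeries_one_sub_ne_zero ((q : ℚ) ^ (n ^ 2 - (n - k) ^ 2 - 1)) hk.1
    simp only [map_mul, map_pow, map_natCast] at h
    simp only [hZ]
    rwa [Nat.sub_sub_self hk.2, ht]
  have hZj : ∀ j < n, Z (n - j) = (q : ℚ⸨X⸩) ^ (n ^ 2 - j ^ 2 - 1) * t ^ (n - j) := by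
    intro j hj
    simp only [hZ]
    rw [Nat.sub_sub_self hj.le]
  have h1 : ∏ j ∈ Finset.range n, (1 - (q : ℚ⸨X⸩) ^ (n ^ 2 - j ^ 2 - 1) * t ^ (n - j)) =
      ∏ i ∈ Finset.Icc 1 n, (1 - Z i) := by
    rw [← prod_range_sub_eq_prod_Icc]
    exact Finset.prod_congr rfl fun j hj => by rw [hZj j (Finset.mem_range.1 hj)]
  have h2 : ∑ w : Equiv.Perm (Fin n), ((q : ℚ⸨X⸩)⁻¹) ^ SymmetricGroup.length w *
        ∏ j ∈ SymmetricGroup.descents w, (q : ℚ⸨X⸩) ^ (n ^ 2 - j ^ 2 - 1) * t ^ (n - j) =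
      ∑ w : Equiv.Perm (Fin n), ((q : ℚ⸨X⸩)⁻¹) ^ SymmetricGroup.length w *
        ∏ j ∈ SymmetricGroup.descents w, Z (n - j) := by
    refine Finset.sum_congr rfl fun w _ => ?_
    congr 1
    exact Finset.prod_congr rfl fun j hj => (hZj j (SymmetricGroup.mem_descents.1 hj).1.2).symm
  rw [h1, h2, ← igusa_eq_sum_perm hY hn hX, ofPowerSeries_imageZeta hn hq ht]
  ring

theorem prod_one_sub_ne_zero (q : ℕ) {t : ℚ⸨X⸩}
    (ht : t = HahnSeries.ofPowerSeries ℤ ℚ PowerSeries.X) :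
    ∏ j ∈ Finset.range n, (1 - (q : ℚ⸨X⸩) ^ (n ^ 2 - j ^ 2 - 1) * t ^ (n - j)) ≠ 0 := by
  refine Finset.prod_ne_zero_iff.2 fun j hj => ?_
  have hj := Finset.mem_range.1 hj
  have h := ofPowerSeries_one_sub_ne_zero ((q : ℚ) ^ (n ^ 2 - j ^ 2 - 1))
    (show 1 ≤ n - j by omega)
  simp only [map_mul, map_pow, map_natCast] at h
  rwa [ht]

/-- Clearing denominators brings the identity back to power series, where it can be evaluated at
complex numbers. -/
theorem imageZeta_mul_prod (hn : 1 ≤ n) {q : ℕ} (hq : q = Nat.card (ResidueField o)) :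
    imageZeta o n * ∏ j ∈ Finset.range n,
        (1 - PowerSeries.C ((q : ℚ) ^ (n ^ 2 - j ^ 2 - 1)) * PowerSeries.X ^ (n - j)) =
      (∑ w : Equiv.Perm (Fin n), PowerSeries.C (((q : ℚ)⁻¹) ^ SymmetricGroup.length w) *
        ∏ j ∈ SymmetricGroup.descents w,
          PowerSeries.C ((q : ℚ) ^ (n ^ 2 - j ^ 2 - 1)) * PowerSeries.X ^ (n - j)) *
      ∏ j ∈ Finset.range n, (1 - PowerSeries.C ((q : ℚ) ^ j) * PowerSeries.X) := by
  refine HahnSeries.ofPowerSeries_injective (Γ := ℤ) ?_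
  have h := ofPowerSeries_imageZeta_eq_sum_perm hn hq rfl
  have hC : HahnSeries.ofPowerSeries ℤ ℚ (PowerSeries.C (q : ℚ)⁻¹) = (q : ℚ⸨X⸩)⁻¹ := by
    have := map_inv₀ ((HahnSeries.ofPowerSeries ℤ ℚ).comp (PowerSeries.C (R := ℚ))) (q : ℚ)
    rwa [map_natCast] at this
  simp only [map_mul, map_prod, map_sub, map_one, map_sum, map_pow, map_natCast, hC]
  exact h

end Laurent

/-! ### Evaluation of power series at complex numbers -/

section Evaluation

open PowerSeries

/-- The power series `f` converges absolutely at `z` with value `v`. -/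
def HasValue (f : ℚ⟦X⟧) (z v : ℂ) : Prop :=
  (Summable fun m => ‖((coeff m f : ℚ) : ℂ) * z ^ m‖) ∧ HasSum (fun m => ((coeff m f : ℚ) : ℂ) * z ^ m) v

variable {z : ℂ}

theorem hasValue_monomial (k : ℕ) (a : ℚ) : HasValue (C a * X ^ k) z (a * z ^ k) := by
  have h : ∀ m, m ≠ k → ((coeff m (C a * X ^ k) : ℚ) : ℂ) * z ^ m = 0 := by
    intro m hm
    rw [coeff_C_mul, coeff_X_pow, if_neg hm]
    simp
  refine ⟨summable_of_ne_finset_zero (s := {k}) fun m hm => ?_, ?_⟩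
  · rw [h m (by simpa using hm), norm_zero]
  · have := hasSum_single (f := fun m => ((coeff m (C a * X ^ k) : ℚ) : ℂ) * z ^ m) k h
    simpa [coeff_X_pow] using this

theorem hasValue_C (a : ℚ) : HasValue (C a) z a := by
  simpa using hasValue_monomial (z := z) 0 a

theorem hasValue_one : HasValue 1 z 1 := by
  simpa using hasValue_C (z := z) 1

theorem hasValue_zero : HasValue 0 z 0 := by
  simpa using hasValue_C (z := z) 0

theorem HasValue.add {f g : ℚ⟦X⟧} {v w : ℂ} (hf : HasValue f z v) (hg : HasValue g z w) :
    HasValue (f + g) z (v + w) := by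
  have h : ∀ m, ((coeff m (f + g) : ℚ) : ℂ) * z ^ m =
      ((coeff m f : ℚ) : ℂ) * z ^ m + ((coeff m g : ℚ) : ℂ) * z ^ m := by
    intro m
    rw [map_add]
    push_cast
    ring
  refine ⟨?_, ?_⟩
  · simp only [h]
    exact Summable.of_nonneg_of_le (fun _ => norm_nonneg _) (fun _ => norm_add_le _ _)
      (hf.1.add hg.1)
  · simp only [h]
    exact hf.2.add hg.2

theorem HasValue.mul {f g : ℚ⟦X⟧} {v w : ℂ} (hf : HasValue f z v) (hg : HasValue g z w) :
    HasValue (f * g) z (v * w) := by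
  have h : ∀ m, ((coeff m (f * g) : ℚ) : ℂ) * z ^ m =
      ∑ p ∈ Finset.HasAntidiagonal.antidiagonal m,
        (((coeff p.1 f : ℚ) : ℂ) * z ^ p.1) * (((coeff p.2 g : ℚ) : ℂ) * z ^ p.2) := by
    intro m
    rw [coeff_mul, Rat.cast_sum, Finset.sum_mul]
    refine Finset.sum_congr rfl fun p hp => ?_
    rw [← Finset.HasAntidiagonal.mem_antidiagonal.1 hp, pow_add]
    push_cast
    ring
  have hs := summable_norm_sum_mul_antidiagonal_of_summable_norm hf.1 hg.1
  refine ⟨?_, ?_⟩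
  · simp only [h]
    exact hs
  · simp only [h]
    rw [← hf.2.tsum_eq, ← hg.2.tsum_eq,
      tsum_mul_tsum_eq_tsum_sum_antidiagonal_of_summable_norm hf.1 hg.1]
    exact hs.of_norm.hasSum

theorem HasValue.one_sub {f : ℚ⟦X⟧} {v : ℂ} (hf : HasValue f z v) :
    HasValue (1 - f) z (1 - v) := by
  have := hasValue_one.add ((hasValue_C (z := z) (-1)).mul hf)
  simpa [sub_eq_add_neg] using this

theorem hasValue_sum {ι : Type*} (s : Finset ι) {f : ι → ℚ⟦X⟧} {v : ι → ℂ}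
    (h : ∀ i ∈ s, HasValue (f i) z (v i)) : HasValue (∑ i ∈ s, f i) z (∑ i ∈ s, v i) := by
  classical
  induction s using Finset.induction_on with
  | empty => simpa using hasValue_zero
  | insert i s hi ih =>
    rw [Finset.sum_insert hi, Finset.sum_insert hi]
    exact (h i (Finset.mem_insert_self _ _)).add
      (ih fun j hj => h j (Finset.mem_insert_of_mem hj))

theorem hasValue_prod {ι : Type*} (s : Finset ι) {f : ι → ℚ⟦X⟧} {v : ι → ℂ}
    (h : ∀ i ∈ s, HasValue (f i) z (v i)) : HasValue (∏ i ∈ s, f i) z (∏ i ∈ s, v i) := by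
  classical
  induction s using Finset.induction_on with
  | empty => simpa using hasValue_one
  | insert i s hi ih =>
    rw [Finset.prod_insert hi, Finset.prod_insert hi]
    exact (h i (Finset.mem_insert_self _ _)).mul
      (ih fun j hj => h j (Finset.mem_insert_of_mem hj))

/-- The inverse is the geometric series in `a X ^ k`, supported on multiples of `k`. -/
theorem exists_hasValue_inv {a : ℚ} {k : ℕ} (hk : 1 ≤ k) (ha : ‖(a : ℂ) * z ^ k‖ < 1) :
    ∃ g : ℚ⟦X⟧, (1 - C a * X ^ k) * g = 1 ∧ HasValue g z (1 - a * z ^ k)⁻¹ := by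
  let g : ℚ⟦X⟧ := PowerSeries.mk fun m => if k ∣ m then a ^ (m / k) else 0
  have hinj : Function.Injective fun j : ℕ => k * j :=
    fun i j h => Nat.eq_of_mul_eq_mul_left hk h
  have hzero : ∀ m ∉ Set.range (fun j : ℕ => k * j), ((coeff m g : ℚ) : ℂ) * z ^ m = 0 := by
    intro m hm
    rw [coeff_mk, if_neg fun ⟨j, hj⟩ => hm ⟨j, hj.symm⟩]
    simp
  have hcomp : ∀ j, ((coeff (k * j) g : ℚ) : ℂ) * z ^ (k * j) = ((a : ℂ) * z ^ k) ^ j := by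
    intro j
    rw [coeff_mk, if_pos (dvd_mul_right _ _), Nat.mul_div_cancel_left _ hk, mul_pow, pow_mul]
    push_cast
    rfl
  refine ⟨g, ?_, ?_, ?_⟩
  · ext m
    rw [sub_mul, one_mul, map_sub, mul_assoc, coeff_C_mul, coeff_X_pow_mul', coeff_one, coeff_mk]
    by_cases hkm : k ≤ m
    · obtain ⟨m, rfl⟩ := Nat.exists_eq_add_of_le' hkm
      rw [if_pos hkm, coeff_mk, Nat.add_sub_cancel, Nat.add_div_right _ hk,
        if_neg (show m + k ≠ 0 by omega)]
      simp only [Nat.dvd_add_self_right]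
      split_ifs <;> ring
    · rw [if_neg hkm, mul_zero, sub_zero]
      rcases Nat.eq_zero_or_pos m with rfl | hm
      · simp
      · rw [if_neg fun h => hkm (Nat.le_of_dvd hm h), if_neg (by omega)]
  · refine (hinj.summable_iff fun m hm => ?_).1 ?_
    · rw [hzero m hm, norm_zero]
    · simp only [Function.comp_def, hcomp, norm_pow]
      exact summable_geometric_of_lt_one (norm_nonneg _) ha
  · refine (hinj.hasSum_iff hzero).1 ?_
    simp only [Function.comp_def, hcomp]
    exact hasSum_geometric_of_norm_lt_one ha

/-- Convergence of a product says nothing by itself about its factor `f`. Here the cofactor has a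
formal inverse that also converges absolutely at `z`, and multiplying by it recovers `f`. -/
theorem HasValue.of_mul_prod {ι : Type*} (s : Finset ι) {a : ι → ℚ} {k : ι → ℕ}
    (hk : ∀ i ∈ s, 1 ≤ k i) (ha : ∀ i ∈ s, ‖(a i : ℂ) * z ^ k i‖ < 1) {f : ℚ⟦X⟧} {v : ℂ}
    (h : HasValue (f * ∏ i ∈ s, (1 - C (a i) * X ^ k i)) z v) :
    HasValue f z (v * ∏ i ∈ s, (1 - (a i : ℂ) * z ^ k i)⁻¹) := by
  have h1 : ∀ i : s, ∃ g : ℚ⟦X⟧, (1 - C (a i) * X ^ k i) * g = 1 ∧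
      HasValue g z (1 - (a i : ℂ) * z ^ k i)⁻¹ :=
    fun i => exists_hasValue_inv (hk i i.2) (ha i i.2)
  choose g hg hg' using h1
  have h2 := h.mul (hasValue_prod Finset.univ fun i _ => hg' i)
  rw [← Finset.prod_coe_sort s fun i => 1 - C (a i) * X ^ k i, mul_assoc,
    ← Finset.prod_mul_distrib, Finset.prod_congr rfl fun i _ => hg i, Finset.prod_const_one,
    mul_one, Finset.prod_coe_sort s fun i => (1 - (a i : ℂ) * z ^ k i)⁻¹] at h2
  exact h2

end Evaluation

/-! ### Compact adic rings -/

/-- An ideal is open in its own adic topology, and an open subgroup of a compact group has finitely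
many cosets. -/
theorem IsAdic.finite_quotient {R : Type*} [CommRing R] [H : TopologicalSpace R] [CompactSpace R]
    {J : Ideal R} (h : IsAdic J) : Finite (R ⧸ J) := by
  change H = J.adicTopology at h
  subst h
  let _ := J.adicTopology
  have := J.nonarchimedean
  have hopen : IsOpen (J.toAddSubgroup : Set R) := by
    have := (J.openAddSubgroup 1).isOpen'
    change IsOpen ((J ^ 1 : Ideal R) : Set R) at this
    rwa [pow_one] at this
  exact AddSubgroup.quotient_finite_of_isOpen J.toAddSubgroup hopen

/-! ### The image zeta function as a Dirichlet series -/

section Dirichlet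

/-- A power series whose coefficients count the fibres of `a` evaluates to the sum of the
monomials `z ^ a p`. -/
theorem HasValue.hasSum_fiber {ι : Type*} {a : ι → ℕ} {f : ℚ⟦X⟧} {z v : ℂ} (h : HasValue f z v)
    (hfin : ∀ m, Finite {p // a p = m})
    (hf : ∀ m, PowerSeries.coeff m f = Nat.card {p // a p = m}) :
    HasSum (fun p => z ^ a p) v := by
  have hconst : ∀ {M : Type} [NormedRing M] (y : M) (m : ℕ),
      HasSum (fun p : {p // a p = m} => y ^ a p) ((Nat.card {p // a p = m} : M) * y ^ m) := by
    intro M _ y m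
    have := hfin m
    have := Fintype.ofFinite {p // a p = m}
    have h1 : (fun p : {p // a p = m} => y ^ a p) = fun _ => y ^ m :=
      funext fun p => by rw [p.2]
    have h2 := hasSum_fintype fun _ : {p // a p = m} => y ^ m
    rwa [Finset.sum_const, Finset.card_univ, nsmul_eq_mul, ← Nat.card_eq_fintype_card, ← h1] at h2
  rw [← (Equiv.sigmaFiberEquiv a).hasSum_iff]
  refine HasSum.sigma_of_hasSum h.2 (fun m => ?_) (Summable.of_norm ?_)
  · rw [hf, Rat.cast_natCast]
    exact hconst z m
  -- The norms summed over one fibre give the coefficient times `‖z‖ ^ m`, so absolute convergence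
  -- of the power series carries over to the family.
  · have hval : ∀ x, ‖((fun p => z ^ a p) ∘ Equiv.sigmaFiberEquiv a) x‖ =
        ‖z‖ ^ a (Equiv.sigmaFiberEquiv a x) := fun x => norm_pow _ _
    simp only [hval]
    refine (summable_sigma_of_nonneg fun _ => by positivity).2 ⟨fun m => (hconst ‖z‖ m).summable, ?_⟩
    convert h.1 using 2 with m
    rw [norm_mul, norm_pow, hf, Rat.cast_natCast, Complex.norm_natCast]
    exact (hconst ‖z‖ m).tsum_eq

theorem natCast_pow_cpow (q a : ℕ) (s : ℂ) : ((q ^ a : ℕ) : ℂ) ^ s = ((q : ℂ) ^ s) ^ a := by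
  induction a with
  | zero => simp
  | succ a ih => rw [pow_succ, pow_succ, Nat.cast_mul, Complex.natCast_mul_natCast_cpow, ih]

theorem natCast_sq_sub_sq_sub_one (R : Type*) [CommRing R] {n j : ℕ} (hj : j < n) :
    ((n ^ 2 - j ^ 2 - 1 : ℕ) : R) = (n : R) ^ 2 - (j : R) ^ 2 - 1 := by
  have h : j ^ 2 < n ^ 2 := Nat.pow_lt_pow_left hj two_ne_zero
  rw [Nat.cast_sub (by omega), Nat.cast_sub h.le]
  push_cast
  rfl

theorem norm_pow_mul_cpow_lt_one {q n j : ℕ} (hq : 1 < q) (hj : j < n) {s : ℂ}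
    (hs : 2 * (n : ℝ) - 2 < s.re) :
    ‖(q : ℂ) ^ (n ^ 2 - j ^ 2 - 1) * ((q : ℂ) ^ (-s)) ^ (n - j)‖ < 1 := by
  have hq0 : (0 : ℝ) < q := by positivity
  have hq1 : (1 : ℝ) < q := by exact_mod_cast hq
  rw [norm_mul, norm_pow, norm_pow, Complex.norm_natCast,
    Complex.norm_natCast_cpow_of_pos (by omega), ← Real.rpow_natCast, ← Real.rpow_natCast,
    ← Real.rpow_mul hq0.le, ← Real.rpow_add hq0]
  refine Real.rpow_lt_one_of_one_lt_of_neg hq1 ?_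
  obtain ⟨k, rfl⟩ := Nat.exists_eq_add_of_lt hj
  rw [natCast_sq_sub_sq_sub_one ℝ hj, Nat.cast_sub hj.le, Complex.neg_re]
  push_cast at hs ⊢
  have hk : (0 : ℝ) ≤ k := k.cast_nonneg
  -- Here `n - j = k + 1`, and at `Re s = 2n - 2` the exponent of `q` equals `-k ^ 2`. Thus `j = n -
  -- 1` is the case that fixes the abscissa.
  nlinarith [mul_lt_mul_of_pos_left hs (by linarith : (0 : ℝ) < (k : ℝ) + 1), sq_nonneg (k : ℝ)]

theorem cpow_igusa_exponent {q n j : ℕ} (hq : 1 < q) (hj : j < n) (s : ℂ) :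
    (q : ℂ) ^ ((n : ℂ) ^ 2 - (j : ℂ) ^ 2 - 1 - s * ((n : ℂ) - (j : ℂ))) =
      (q : ℂ) ^ (n ^ 2 - j ^ 2 - 1) * ((q : ℂ) ^ (-s)) ^ (n - j) := by
  have hq0 : (q : ℂ) ≠ 0 := by exact_mod_cast (by omega : q ≠ 0)
  rw [← Complex.cpow_nat_mul, ← Complex.cpow_natCast (q : ℂ) (n ^ 2 - j ^ 2 - 1),
    ← Complex.cpow_add _ _ hq0, natCast_sq_sub_sq_sub_one ℂ hj, Nat.cast_sub hj.le]
  congr 1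
  ring

theorem cpow_natCast_sub {q : ℕ} (hq : 1 < q) (j : ℕ) (s : ℂ) :
    (q : ℂ) ^ ((j : ℂ) - s) = (q : ℂ) ^ j * (q : ℂ) ^ (-s) := by
  have hq0 : (q : ℂ) ≠ 0 := by exact_mod_cast (by omega : q ≠ 0)
  rw [← Complex.cpow_natCast, ← Complex.cpow_add _ _ hq0, sub_eq_add_neg]

variable {o : Type*} [CommRing o] [IsDomain o] [IsDiscreteValuationRing o]
  [Finite (IsLocalRing.ResidueField o)] {n : ℕ}

theorem hasValue_imageZeta (hn : 1 ≤ n) {q : ℕ} (hq : q = Nat.card (IsLocalRing.ResidueField o))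
    {s : ℂ} (hs : 2 * (n : ℝ) - 2 < s.re) :
    HasValue (imageZeta o n) ((q : ℂ) ^ (-s))
      ((∑ w : Equiv.Perm (Fin n), (q : ℂ) ^ (-(SymmetricGroup.length w : ℂ)) *
          ∏ j ∈ SymmetricGroup.descents w,
            (q : ℂ) ^ ((n : ℂ) ^ 2 - (j : ℂ) ^ 2 - 1 - s * ((n : ℂ) - (j : ℂ)))) *
        ∏ j ∈ Finset.range n, (1 - (q : ℂ) ^ ((j : ℂ) - s)) /
          (1 - (q : ℂ) ^ ((n : ℂ) ^ 2 - (j : ℂ) ^ 2 - 1 - s * ((n : ℂ) - (j : ℂ))))) := by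
  have hq1 : 1 < q := hq ▸ one_lt_card_residueField o
  have hnum := (hasValue_sum Finset.univ fun (w : Equiv.Perm (Fin n)) _ =>
    (hasValue_C (z := (q : ℂ) ^ (-s)) ((q : ℚ)⁻¹ ^ SymmetricGroup.length w)).mul
      (hasValue_prod (SymmetricGroup.descents w) fun j _ =>
        hasValue_monomial (n - j) ((q : ℚ) ^ (n ^ 2 - j ^ 2 - 1)))).mul
    (hasValue_prod (Finset.range n) fun j _ => (hasValue_monomial 1 ((q : ℚ) ^ j)).one_sub)
  simp only [pow_one] at hnum
  rw [← imageZeta_mul_prod hn hq] at hnum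
  have h := hnum.of_mul_prod (Finset.range n)
    (fun j hj => by have := Finset.mem_range.1 hj; omega)
    (fun j hj => by
      have := norm_pow_mul_cpow_lt_one hq1 (Finset.mem_range.1 hj) hs
      push_cast
      exact this)
  convert h using 1
  rw [mul_assoc, ← Finset.prod_mul_distrib]
  congr 1
  · refine Finset.sum_congr rfl fun w _ => ?_
    congr 1
    · push_cast
      rw [Complex.cpow_neg, Complex.cpow_natCast, inv_pow]
    · refine Finset.prod_congr rfl fun j hj => ?_
      rw [cpow_igusa_exponent hq1 (SymmetricGroup.mem_descents.1 hj).1.2]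
      push_cast
      rfl
  · refine Finset.prod_congr rfl fun j hj => ?_
    rw [cpow_igusa_exponent hq1 (Finset.mem_range.1 hj), cpow_natCast_sub hq1, div_eq_mul_inv]
    push_cast
    rfl

/-- With `|im x| = q ^ a`, each term is `t ^ a` at `t = q ^ (-s)`, and the coefficients of
`imageZeta` count the fibres of `a`. -/
theorem hasSum_imageSize_cpow (hn : 1 ≤ n) {q : ℕ}
    (hq : q = Nat.card (IsLocalRing.ResidueField o)) {s v : ℂ}
    (h : HasValue (imageZeta o n) ((q : ℂ) ^ (-s)) v) :
    HasSum (fun p : PrimitiveTraceless o n => (imageSize p : ℂ) ^ (-s)) v := by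
  have hq1 : 1 < q := hq ▸ one_lt_card_residueField o
  choose a ha using fun p : PrimitiveTraceless o n => exists_imageSize_eq p
  have hiff : ∀ m p, a p = m ↔ imageSize p = Nat.card (IsLocalRing.ResidueField o) ^ m := by
    intro m p
    rw [ha p, ← hq]
    exact (Nat.pow_right_injective hq1).eq_iff.symm
  have hsum := h.hasSum_fiber (a := a)
    (fun m => by simp only [hiff]; exact finite_imageSize_eq hn m)
    (fun m => by simp only [hiff]; rw [imageZeta, PowerSeries.coeff_mk])
  convert hsum using 2 with p
  rw [ha p, ← hq, natCast_pow_cpow]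

end Dirichlet

theorem theorem1p1 (o : Type*) [CommRing o] [IsDomain o] [IsDiscreteValuationRing o]
    [TopologicalSpace o] [CompactSpace o] (hadic : IsAdic (IsLocalRing.maximalIdeal o))
    (q : ℕ) (hq : q = Nat.card (IsLocalRing.ResidueField o))
    (n : ℕ) (hn : 1 ≤ n) :
    -- the power series is well defined: every image size is a power of `q`, and each power of `q`
    -- is the image size of only finitely many primitive matrices
    (∀ p : PrimitiveTraceless o n, ∃ m : ℕ, imageSize p = q ^ m) ∧
    (∀ m : ℕ, Finite {p : PrimitiveTraceless o n // imageSize p = q ^ m}) ∧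
    -- the identities, in the field of formal Laurent series in `t = q ^ (-s)`
    (∀ t : ℚ⸨X⸩, t = HahnSeries.ofPowerSeries ℤ ℚ PowerSeries.X →
      HahnSeries.ofPowerSeries ℤ ℚ (imageZeta o n) =
          (∑ w : Equiv.Perm (Fin n), ((q : ℚ⸨X⸩)⁻¹) ^ SymmetricGroup.length w *
            ∏ j ∈ SymmetricGroup.descents w, (q : ℚ⸨X⸩) ^ (n ^ 2 - j ^ 2 - 1) * t ^ (n - j)) *
          ∏ j ∈ Finset.range n, (1 - (q : ℚ⸨X⸩) ^ j * t) /
            (1 - (q : ℚ⸨X⸩) ^ (n ^ 2 - j ^ 2 - 1) * t ^ (n - j)) ∧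
      HahnSeries.ofPowerSeries ℤ ℚ (imageZeta o n) =
          igusa n (q : ℚ⸨X⸩)⁻¹
            (fun k => (q : ℚ⸨X⸩) ^ (n ^ 2 - (n - k) ^ 2 - 1) * t ^ (n - (n - k))) *
          ∏ j ∈ Finset.range n, (1 - (q : ℚ⸨X⸩) ^ j * t)) ∧
    -- the identity of functions of the complex variable `s`
    (∀ s : ℂ, 2 * (n : ℝ) - 2 < s.re →
      HasSum (fun p : PrimitiveTraceless o n => (imageSize p : ℂ) ^ (-s))
        ((∑ w : Equiv.Perm (Fin n), (q : ℂ) ^ (-(SymmetricGroup.length w : ℂ)) *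
            ∏ j ∈ SymmetricGroup.descents w,
              (q : ℂ) ^ ((n : ℂ) ^ 2 - (j : ℂ) ^ 2 - 1 - s * ((n : ℂ) - (j : ℂ)))) *
          ∏ j ∈ Finset.range n, (1 - (q : ℂ) ^ ((j : ℂ) - s)) /
            (1 - (q : ℂ) ^ ((n : ℂ) ^ 2 - (j : ℂ) ^ 2 - 1 - s * ((n : ℂ) - (j : ℂ)))))) := by
  have : Finite (IsLocalRing.ResidueField o) := hadic.finite_quotient
  refine ⟨fun p => hq ▸ exists_imageSize_eq p, fun m => hq ▸ finite_imageSize_eq hn m,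
    fun t ht => ⟨?_, ofPowerSeries_imageZeta hn hq ht⟩,
    fun s hs => hasSum_imageSize_cpow hn hq (hasValue_imageZeta hn hq hs)⟩
  rw [Finset.prod_div_distrib, ← mul_div_assoc, eq_div_iff (prod_one_sub_ne_zero q ht)]
  exact ofPowerSeries_imageZeta_eq_sum_perm hn hq ht
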